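/- **Setting.** Let $p\ge2$ and let $(x_1,\dots,x_p,y_1,\dots,y_p)$ be the coordinates of $\mathbb{R}^{2p}$, with coordinate vector fields $\partial_i^x,\partial_i^y$. Let $f=f(x)$ be a smooth function on $\mathbb{R}^p$ whose Hessian matrix $H_f=(H_{f,ij})$, $H_{f,ij}=\partial_i^x\partial_j^xf$, is positive definite at every point, and let $(H_f^{ij})$ be its inverse. Let $\mathcal{M}_{1,p,f}=(\mathbb{R}^{2p},g_{1,p,f})$, where $$g_{1,p,f}(\partial_i^x,\partial_j^x)=\partial_i^xf\cdot\partial_j^xf,\qquad g_{1,p,f}(\partial_i^x,\partial_j^y)=\delta_{ij},\qquad g_{1,p,f}(\partial_i^y,\partial_j^y)=0.$$ Let $\nabla$ be the Levi-Civita connection, $R_{1,p,f}(x,y,z,w)=g_{1,p,f}\big((\nabla_x\nabla_y-\nabla_y\nabla_x-\nabla_{[x,y]})z,w\big)$ the curvature tensor, and $\nabla R_{1,p,f}(x,y,z,w;v)$ its covariant derivative in the direction $v$. Let $\mathcal{U}_{1,p}=(\mathbb{R}^{2p},g_{1,p},A_{1,p})$ where, in a basis $X_1,\dots,X_p,Y_1,\dots,Y_p$,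 the non-zero components are $$g_{1,p}(X_i,Y_i)=g_{1,p}(Y_i,X_i)=1,\qquad A_{1,p}(X_i,X_j,X_k,X_l)=\delta_{il}\delta_{jk}-\delta_{ik}\delta_{jl}.$$ A triple $(V,g,A)$ consisting of a finite-dimensional real vector space, a non-degenerate symmetric inner product and an algebraic curvature tensor (a $4$-tensor with the symmetries of a Riemann tensor) is a *$0$-model* for a pseudo-Riemannian manifold $M$ if for every $P\in M$ there is a linear isomorphism $T_PM\to V$ pulling $g$ and $A$ back to the metric and the curvature tensor at $P$. It is *irreducible* if $V\neq0$ and there is no decomposition $V=V_1\oplus V_2$ with $V_1,V_2\ne0$, $g=g_1\oplus g_2$, $A=A_1\oplus A_2$. *$1$-models* $(V,g,A,A^1)$ are defined likewise, $A^1$ being an algebraic covariant derivative curvature tensor that has to pull back to $\nabla R$; $M$ is *$1$-curvature homogeneous* if it has a $1$-model. A connected pseudo-Riemannian manifold is a *symmetric space* if every point $P$ is fixed by an isometry of the whole manifold whose differential at $P$ is $-\mathrm{id}$. A pseudo-Riemannian manifold is called *irreducible* if $(T_PM,g_P,R_P)$ is irreducible for every $P$ and $TM$ has no orthogonal direct sum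 decomposition into two non-zero subbundles that are invariant under parallel transport. Put $$\alpha_1=\sum_{a,b,c,d,e,s,t,u,v,w}H_f^{as}H_f^{bt}H_f^{cu}H_f^{dv}H_f^{ew}\,\nabla R_{1,p,f}(\partial_a^x,\partial_b^x,\partial_c^x,\partial_d^x;\partial_e^x)\,\nabla R_{1,p,f}(\partial_s^x,\partial_t^x,\partial_u^x,\partial_v^x;\partial_w^x).$$ **Theorem.** The metric $g_{1,p,f}$ and the inner product $g_{1,p}$ have signature $(p,p)$, and: 1. Every geodesic of $\mathcal{M}_{1,p,f}$ extends to a geodesic defined on all of $\mathbb{R}$. 2. For every $P\in\mathbb{R}^{2p}$, $\exp_P:T_P\mathbb{R}^{2p}\to\mathbb{R}^{2p}$ is defined on all of $T_P\mathbb{R}^{2p}$ and is a diffeomorphism. 3. For all indices, (a) $R_{1,p,f}(\partial_i^x,\partial_j^x,\partial_k^x,\partial_l^x)=H_{f,il}H_{f,jk}-H_{f,ik}H_{f,jl}$, and (b) $\nabla R_{1,p,f}(\partial_i^x,\partial_j^x,\partial_k^x,\partial_l^x;\partial_n^x)=\partial_n^x\big(R_{1,p,f}(\partial_i^x,\partial_j^x,\partial_k^x,\partial_l^x)\big)$;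 every component of $R_{1,p,f}$ or of $\nabla R_{1,p,f}$ with at least one entry $\partial_m^y$ vanishes. 4. $\mathcal{U}_{1,p}$ is a $0$-model for $\mathcal{M}_{1,p,f}$ and is irreducible. 5. If $f=x_1^2+\dots+x_p^2$, then $\mathcal{M}_{1,p,f}$ is an irreducible symmetric space. 6. If $p\ge3$ and $\alpha_1$ is not constant, then $\mathcal{M}_{1,p,f}$ is not $1$-curvature homogeneous. -/

import Mathlib

open scoped ContDiff Manifold

noncomputable section

/-! ### Algebraic curvature models -/

/-- A triple `(V, g, A)`: a non-degenerate symmetric inner product `g` (of any signature) and an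
algebraic curvature tensor `A ∈ ⊗⁴ V*` on a real vector space. -/
structure ZeroModel (V : Type*) [AddCommGroup V] [Module ℝ V] where
  g : LinearMap.BilinForm ℝ V
  g_symm : ∀ x y, g x y = g y x
  g_nondeg : g.Nondegenerate
  A : MultilinearMap ℝ (fun _ : Fin 4 => V) ℝ
  A_antisymm : ∀ x y z w, A ![x, y, z, w] = -A ![y, x, z, w]
  A_pair : ∀ x y z w, A ![x, y, z, w] = A ![z, w, x, y]
  A_bianchi : ∀ x y z w, A ![x, y, z, w] + A ![y, z, x, w] + A ![z, x, y, w] = 0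

/-- A quadruple `(V, g, A, A¹)`: a `0`-model with an algebraic covariant derivative curvature
tensor `A¹ ∈ ⊗⁵ V*`; the value `A¹(x, y, z, w; v)` is `A1 ![x, y, z, w, v]`. -/
structure OneModel (V : Type*) [AddCommGroup V] [Module ℝ V] extends ZeroModel V where
  A1 : MultilinearMap ℝ (fun _ : Fin 5 => V) ℝ
  A1_antisymm : ∀ x y z w v, A1 ![x, y, z, w, v] = -A1 ![y, x, z, w, v]
  A1_pair : ∀ x y z w v, A1 ![x, y, z, w, v] = A1 ![z, w, x, y, v]
  A1_bianchi : ∀ x y z w v,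
    A1 ![x, y, z, w, v] + A1 ![y, z, x, w, v] + A1 ![z, x, y, w, v] = 0
  A1_bianchi₂ : ∀ x y z w v,
    A1 ![x, y, z, w, v] + A1 ![x, y, w, v, z] + A1 ![x, y, v, z, w] = 0

/-- `V = V₁ ⊕ V₂`, with `g = g₁ ⊕ g₂` and `A = A₁ ⊕ A₂`. -/
structure IsModelDecomposition {V : Type*} [AddCommGroup V] [Module ℝ V]
    (g : V → V → ℝ) (A : V → V → V → V → ℝ) (V₁ V₂ : Submodule ℝ V) : Prop where
  isCompl : IsCompl V₁ V₂
  g_split : ∀ x ∈ V₁, ∀ x' ∈ V₁, ∀ y ∈ V₂, ∀ y' ∈ V₂,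
    g (x + y) (x' + y') = g x x' + g y y'
  A_split : ∀ x₁ ∈ V₁, ∀ x₂ ∈ V₁, ∀ x₃ ∈ V₁, ∀ x₄ ∈ V₁,
    ∀ y₁ ∈ V₂, ∀ y₂ ∈ V₂, ∀ y₃ ∈ V₂, ∀ y₄ ∈ V₂,
    A (x₁ + y₁) (x₂ + y₂) (x₃ + y₃) (x₄ + y₄) = A x₁ x₂ x₃ x₄ + A y₁ y₂ y₃ y₄

/-- The model `(V, g, A)` is nonzero and has no non-trivial decomposition. -/
def IsIrreducibleModel {V : Type*} [AddCommGroup V] [Module ℝ V]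
    (g : V → V → ℝ) (A : V → V → V → V → ℝ) : Prop :=
  Nontrivial V ∧
    ∀ V₁ V₂ : Submodule ℝ V, IsModelDecomposition g A V₁ V₂ → V₁ = ⊥ ∨ V₂ = ⊥

def ZeroModel.IsIrreducible {V : Type*} [AddCommGroup V] [Module ℝ V] (U : ZeroModel V) : Prop :=
  IsIrreducibleModel (fun x y => U.g x y) (fun x y z w => U.A ![x, y, z, w])

/-- A symmetric bilinear form has signature `(p, q)`: `p` negative and `q` positive directions. -/
def HasSignature {V : Type*} [AddCommGroup V] [Module ℝ V]
    (B : LinearMap.BilinForm ℝ V) (p q : ℕ) : Prop :=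
  sigNeg B.toQuadraticMap = p ∧ sigPos B.toQuadraticMap = q

/-! ### Pseudo-Riemannian metrics on a vector space, in its global chart -/

/-- A smooth pseudo-Riemannian metric on the manifold `E` (a finite-dimensional real vector space);
every tangent space `T_P E` is identified with `E`. -/
structure PseudoRiemannianMetric (E : Type*) [NormedAddCommGroup E] [NormedSpace ℝ E] where
  val : E → LinearMap.BilinForm ℝ E
  symm : ∀ P u v, val P u v = val P v u
  nondeg : ∀ P, (val P).Nondegenerate
  smooth : ∀ u v, ContDiff ℝ ∞ fun P => val P u v

namespace PseudoRiemannianMetric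

variable {E : Type*} [NormedAddCommGroup E] [NormedSpace ℝ E]

theorem differentiableAt (g : PseudoRiemannianMetric E) (u v P : E) :
    DifferentiableAt ℝ (fun Q => g.val Q u v) P :=
  (g.smooth u v).differentiable (by simp) P

/-- The Koszul formula on constant vector fields `u, v, w`:
`g(∇_u v, w) = ½ (u g(v, w) + v g(u, w) - w g(u, v))`, as a linear functional of `w`. -/
def koszul (g : PseudoRiemannianMetric E) (P u v : E) : Module.Dual ℝ E where
  toFun w := (1 / 2 : ℝ) * (fderiv ℝ (fun Q => g.val Q v w) P u
    + fderiv ℝ (fun Q => g.val Q u w) P v - fderiv ℝ (fun Q => g.val Q u v) P w)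
  map_add' w w' := by
    have h : ∀ a, fderiv ℝ (fun Q => g.val Q a (w + w')) P
        = fderiv ℝ (fun Q => g.val Q a w) P + fderiv ℝ (fun Q => g.val Q a w') P := by
      intro a
      simp only [map_add]
      exact fderiv_add (g.differentiableAt a w P) (g.differentiableAt a w' P)
    rw [h, h, add_apply, add_apply, map_add]
    ring
  map_smul' c w := by
    have h : ∀ a, fderiv ℝ (fun Q => g.val Q a (c • w)) P
        = c • fderiv ℝ (fun Q => g.val Q a w) P := by
      intro a
      simp only [map_smul]
      exact fderiv_const_smul (g.differentiableAt a w P) c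
    rw [h, h, smul_apply, smul_apply, map_smul]
    simp only [smul_eq_mul, RingHom.id_apply]
    ring

variable [FiniteDimensional ℝ E]

/-- The Christoffel symbol of the Levi-Civita connection: `Γ_P(u, v) = (∇_u v)(P)` for constant
vector fields `u, v`. -/
def christoffel (g : PseudoRiemannianMetric E) (P u v : E) : E :=
  ((g.val P).toDual (g.nondeg P)).symm (g.koszul P u v)

/-- The Levi-Civita derivative `∇_X Y` of vector fields. -/
def covDeriv (g : PseudoRiemannianMetric E) (X Y : E → E) : E → E := fun P =>
  fderiv ℝ Y P (X P) + g.christoffel P (X P) (Y P)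

/-- The curvature operator `R(u, v) w = ∇_u ∇_v w - ∇_v ∇_u w`, computed on the constant (hence
commuting) vector fields extending the tangent vectors `u, v, w` at `P`. -/
def curvOp (g : PseudoRiemannianMetric E) (P u v w : E) : E :=
  g.covDeriv (fun _ => u) (g.covDeriv (fun _ => v) (fun _ => w)) P
    - g.covDeriv (fun _ => v) (g.covDeriv (fun _ => u) (fun _ => w)) P

/-- The curvature tensor `R(x, y, z, w) = g(R(x, y) z, w)` at `P`. -/
def curv (g : PseudoRiemannianMetric E) (P x y z w : E) : ℝ :=
  g.val P (g.curvOp P x y z) w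

/-- The covariant derivative `∇R(x, y, z, w; v) = (∇_v R)(x, y, z, w)` at `P`. -/
def covCurv (g : PseudoRiemannianMetric E) (P x y z w v : E) : ℝ :=
  fderiv ℝ (fun Q => g.curv Q x y z w) P v
    - g.curv P (g.christoffel P v x) y z w - g.curv P x (g.christoffel P v y) z w
    - g.curv P x y (g.christoffel P v z) w - g.curv P x y z (g.christoffel P v w)

/-! ### Geodesics -/

/-- `γ` restricted to the open set `I ⊆ ℝ` is a smooth solution of `γ'' + Γ_γ(γ', γ') = 0`. -/
def IsGeodesicOn (g : PseudoRiemannianMetric E) (γ : ℝ → E) (I : Set ℝ) : Prop :=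
  ContDiffOn ℝ ∞ γ I ∧
    ∀ t ∈ I, deriv (deriv γ) t + g.christoffel (γ t) (deriv γ t) (deriv γ t) = 0

/-- Every geodesic defined on an open interval extends to a geodesic defined on all of `ℝ`. -/
def IsGeodesicallyComplete (g : PseudoRiemannianMetric E) : Prop :=
  ∀ (I : Set ℝ) (γ : ℝ → E), IsOpen I → I.OrdConnected → I.Nonempty → g.IsGeodesicOn γ I →
    ∃ γ' : ℝ → E, g.IsGeodesicOn γ' Set.univ ∧ Set.EqOn γ' γ I

/-- The graph of the exponential map: `exp_P v = Q`, i.e. some geodesic `γ`, defined on an open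
interval containing `[0, 1]`, satisfies `γ(0) = P`, `γ'(0) = v`, `γ(1) = Q`. -/
def IsExp (g : PseudoRiemannianMetric E) (P v Q : E) : Prop :=
  ∃ (I : Set ℝ) (γ : ℝ → E), IsOpen I ∧ I.OrdConnected ∧ Set.Icc 0 1 ⊆ I ∧ g.IsGeodesicOn γ I ∧
    γ 0 = P ∧ deriv γ 0 = v ∧ γ 1 = Q

/-- `exp_P` is a well-defined map on all of `T_P E`, and is a diffeomorphism onto `E`. -/
def ExpIsDiffeomorphism (g : PseudoRiemannianMetric E) (P : E) : Prop :=
  ∃ Φ : E ≃ₘ^∞⟮𝓘(ℝ, E), 𝓘(ℝ, E)⟯ E, ∀ v Q, g.IsExp P v Q ↔ Φ v = Q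

/-! ### Models for a pseudo-Riemannian manifold -/

/-- `U` is a `0`-model: every `T_P E` is isomorphic to `(V, g, A)`. -/
def IsZeroModel (g : PseudoRiemannianMetric E) {V : Type*} [AddCommGroup V] [Module ℝ V]
    (U : ZeroModel V) : Prop :=
  ∀ P : E, ∃ Φ : E ≃ₗ[ℝ] V,
    (∀ x y, U.g (Φ x) (Φ y) = g.val P x y) ∧
    (∀ x y z w, U.A ![Φ x, Φ y, Φ z, Φ w] = g.curv P x y z w)

/-- `U` is a `1`-model: every `T_P E` is isomorphic to `(V, g, A, A¹)`. -/
def IsOneModel (g : PseudoRiemannianMetric E) {V : Type*} [AddCommGroup V] [Module ℝ V]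
    (U : OneModel V) : Prop :=
  ∀ P : E, ∃ Φ : E ≃ₗ[ℝ] V,
    (∀ x y, U.g (Φ x) (Φ y) = g.val P x y) ∧
    (∀ x y z w, U.A ![Φ x, Φ y, Φ z, Φ w] = g.curv P x y z w) ∧
    (∀ x y z w v, U.A1 ![Φ x, Φ y, Φ z, Φ w, Φ v] = g.covCurv P x y z w v)

/-- The manifold admits a `1`-model. (The model space is isomorphic to a tangent space, so it is no
restriction that it lies in the universe of `E`.) -/
def IsOneCurvatureHomogeneous.{u} {E : Type u} [NormedAddCommGroup E] [NormedSpace ℝ E]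
    [FiniteDimensional ℝ E] (g : PseudoRiemannianMetric E) : Prop :=
  ∃ (V : Type u) (_ : AddCommGroup V) (_ : Module ℝ V) (U : OneModel V), g.IsOneModel U

/-! ### Symmetric spaces and irreducibility -/

/-- Every point `P` is fixed by an isometry of the manifold with differential `-id` at `P`.
(The manifold, a vector space, is connected.) -/
def IsSymmetricSpace (g : PseudoRiemannianMetric E) : Prop :=
  ∀ P : E, ∃ S : E ≃ₘ^∞⟮𝓘(ℝ, E), 𝓘(ℝ, E)⟯ E,
    (∀ Q u v, g.val (S Q) (fderiv ℝ S Q u) (fderiv ℝ S Q v) = g.val Q u v) ∧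
    S P = P ∧ ∀ v, fderiv ℝ S P v = -v

/-- `V` is a parallel vector field along the smooth curve `γ`. -/
def IsParallelAlong (g : PseudoRiemannianMetric E) (γ V : ℝ → E) : Prop :=
  ContDiff ℝ ∞ V ∧ ∀ t, deriv V t + g.christoffel (γ t) (deriv γ t) (V t) = 0

/-- The family `D` of tangent subspaces is invariant under parallel transport. -/
def IsParallelDistribution (g : PseudoRiemannianMetric E) (D : E → Submodule ℝ E) : Prop :=
  ∀ γ V : ℝ → E, ContDiff ℝ ∞ γ → g.IsParallelAlong γ V →
    ∀ s t, V s ∈ D (γ s) → V t ∈ D (γ t)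

/-- The tangent bundle has no non-trivial orthogonal decomposition into parallel distributions
(equivalently, no proper non-trivial non-degenerate subspace of a tangent space is invariant under
the holonomy group); in particular the manifold is not a product of two pseudo-Riemannian manifolds
of positive dimension. -/
def IsIndecomposable (g : PseudoRiemannianMetric E) : Prop :=
  ∀ D₁ D₂ : E → Submodule ℝ E, g.IsParallelDistribution D₁ → g.IsParallelDistribution D₂ →
    (∀ P, IsCompl (D₁ P) (D₂ P)) → (∀ P, ∀ x ∈ D₁ P, ∀ y ∈ D₂ P, g.val P x y = 0) →
    (∀ P, D₁ P = ⊥) ∨ (∀ P, D₂ P = ⊥)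

/-- Irreducibility of a pseudo-Riemannian manifold: it is not locally decomposable at the level of
curvature at any point, nor decomposable under parallel transport. (Invariant subspaces on which
the metric is degenerate are allowed, as usual in indefinite signature.) -/
structure IsIrreducible (g : PseudoRiemannianMetric E) : Prop where
  tangent : ∀ P, IsIrreducibleModel (fun x y => g.val P x y) (g.curv P)
  indecomposable : g.IsIndecomposable

end PseudoRiemannianMetric

/-! ### The manifolds `(ℝ^{2p}, g_{1,p,f})` -/

/-- `ℝ^{2p}`, with coordinates `(x, y) = (x₁, …, x_p, y₁, …, y_p)`. -/
abbrev R2p (p : ℕ) : Type := (Fin p → ℝ) × (Fin p → ℝ)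

/-- The basis `∂₁ˣ, …, ∂_pˣ, ∂₁ʸ, …, ∂_pʸ` (`X₁, …, X_p, Y₁, …, Y_p` for the model) of `ℝ^{2p}`. -/
def coordVec {p : ℕ} : Fin p ⊕ Fin p → R2p p
  | Sum.inl i => (Pi.single i 1, 0)
  | Sum.inr i => (0, Pi.single i 1)

abbrev dx {p : ℕ} (i : Fin p) : R2p p := coordVec (Sum.inl i)

abbrev dy {p : ℕ} (i : Fin p) : R2p p := coordVec (Sum.inr i)

/-- The partial derivative `∂ᵢ F` of a function on `ℝ^p`. -/
def pderiv {p : ℕ} (i : Fin p) (F : (Fin p → ℝ) → ℝ) (x : Fin p → ℝ) : ℝ :=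
  fderiv ℝ F x (Pi.single i 1)

/-- The Hessian matrix `H_{f,ij} = ∂ᵢ ∂ⱼ f`. -/
def hess {p : ℕ} (f : (Fin p → ℝ) → ℝ) (x : Fin p → ℝ) : Matrix (Fin p) (Fin p) ℝ :=
  Matrix.of fun i j => pderiv i (pderiv j f) x

/-- The bilinear form on `ℝ^{2p}` with `(∂ᵢˣ, ∂ⱼˣ) ↦ aᵢ aⱼ`, `(∂ᵢˣ, ∂ⱼʸ) ↦ δᵢⱼ`,
`(∂ᵢʸ, ∂ⱼʸ) ↦ 0`. -/
def neutralForm {p : ℕ} (a : Fin p → ℝ) : LinearMap.BilinForm ℝ (R2p p) :=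
  LinearMap.mk₂ ℝ
    (fun u v => (∑ i, a i * u.1 i) * (∑ i, a i * v.1 i) + ∑ i, (u.1 i * v.2 i + u.2 i * v.1 i))
    (by
      intro u u' v
      simp only [Prod.fst_add, Prod.snd_add, Pi.add_apply, mul_add, add_mul,
        Finset.sum_add_distrib]
      ring)
    (by
      intro c u v
      simp only [Prod.smul_fst, Prod.smul_snd, Pi.smul_apply, smul_eq_mul, mul_add,
        Finset.mul_sum, Finset.sum_mul, Finset.sum_add_distrib]
      congr 1
      · exact Finset.sum_congr rfl fun i _ => Finset.sum_congr rfl fun j _ => by ring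
      · congr 1 <;> exact Finset.sum_congr rfl fun i _ => by ring)
    (by
      intro u v v'
      simp only [Prod.fst_add, Prod.snd_add, Pi.add_apply, mul_add,
        Finset.sum_add_distrib]
      ring)
    (by
      intro c u v
      simp only [Prod.smul_fst, Prod.smul_snd, Pi.smul_apply, smul_eq_mul, mul_add,
        Finset.mul_sum, Finset.sum_mul, Finset.sum_add_distrib]
      congr 1
      · exact Finset.sum_congr rfl fun i _ => Finset.sum_congr rfl fun j _ => by ring
      · congr 1 <;> exact Finset.sum_congr rfl fun i _ => by ring)

theorem neutralForm_apply {p : ℕ} (a : Fin p → ℝ) (u v : R2p p) :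
    neutralForm a u v =
      (∑ i, a i * u.1 i) * (∑ i, a i * v.1 i) + ∑ i, (u.1 i * v.2 i + u.2 i * v.1 i) := rfl

theorem neutralForm_symm {p : ℕ} (a : Fin p → ℝ) (u v : R2p p) :
    neutralForm a u v = neutralForm a v u := by
  simp only [neutralForm_apply]
  rw [mul_comm]
  congr 1
  exact Finset.sum_congr rfl fun i _ => by ring

theorem neutralForm_nondegenerate {p : ℕ} (a : Fin p → ℝ) : (neutralForm a).Nondegenerate := by
  have h : ∀ u : R2p p, (∀ v, neutralForm a u v = 0) → u = 0 := by
    intro u hu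
    have h1 : u.1 = 0 := by
      funext i
      have := hu (0, Pi.single i 1)
      simpa [neutralForm_apply, Pi.single_apply] using this
    have h2 : u.2 = 0 := by
      funext i
      have := hu (Pi.single i 1, 0)
      simpa [neutralForm_apply, Pi.single_apply, h1] using this
    exact Prod.ext h1 h2
  refine ⟨h, fun u hu => h u fun v => ?_⟩
  rw [neutralForm_symm]
  exact hu v

theorem contDiff_pderiv {p : ℕ} {f : (Fin p → ℝ) → ℝ} (hf : ContDiff ℝ ∞ f) (i : Fin p) :
    ContDiff ℝ ∞ (pderiv i f) :=
  (hf.fderiv_right (m := ∞) (by simp)).clm_apply contDiff_const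

/-- The metric `g_{1,p,f}` on `ℝ^{2p}`: `g(∂ᵢˣ, ∂ⱼˣ) = ∂ᵢ f · ∂ⱼ f`, `g(∂ᵢˣ, ∂ᵢʸ) = 1`, the other
components being zero. -/
def metric1 {p : ℕ} (f : (Fin p → ℝ) → ℝ) (hf : ContDiff ℝ ∞ f) :
    PseudoRiemannianMetric (R2p p) where
  val P := neutralForm fun i => pderiv i f P.1
  symm _ := neutralForm_symm _
  nondeg _ := neutralForm_nondegenerate _
  smooth u v := by
    simp only [neutralForm_apply]
    have h : ∀ i, ContDiff ℝ ∞ fun P : R2p p => pderiv i f P.1 := fun i =>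
      (contDiff_pderiv hf i).comp contDiff_fst
    refine ((ContDiff.sum fun i _ => (h i).mul contDiff_const).mul
      (ContDiff.sum fun i _ => (h i).mul contDiff_const)).add contDiff_const

/-- The components `A_{1,p}(ξ₁, ξ₂, ξ₃, ξ₄) = ⟨ξ₁,ξ₄⟩⟨ξ₂,ξ₃⟩ - ⟨ξ₁,ξ₃⟩⟨ξ₂,ξ₄⟩`, where
`⟨ξ, η⟩ = ∑ ξᵢ ηᵢ` over the `X`-coordinates. -/
def modelCurv (p : ℕ) : MultilinearMap ℝ (fun _ : Fin 4 => R2p p) ℝ where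
  toFun ξ := ((ξ 0).1 ⬝ᵥ (ξ 3).1) * ((ξ 1).1 ⬝ᵥ (ξ 2).1)
    - ((ξ 0).1 ⬝ᵥ (ξ 2).1) * ((ξ 1).1 ⬝ᵥ (ξ 3).1)
  map_update_add' := by
    intro inst ξ i x y
    have h : ∀ z : R2p p, ∀ k, Function.update ξ i z k = if k = i then z else ξ k :=
      fun z k => Function.update_apply ξ i z k
    simp only [h]
    split_ifs <;> first
      | omega
      | (simp only [Prod.fst_add, add_dotProduct, dotProduct_add]; ring)
  map_update_smul' := by
    intro inst ξ i c x
    have h : ∀ z : R2p p, ∀ k, Function.update ξ i z k = if k = i then z else ξ k :=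
      fun z k => Function.update_apply ξ i z k
    simp only [h]
    split_ifs <;> first
      | omega
      | (simp only [Prod.smul_fst, smul_dotProduct, dotProduct_smul, smul_eq_mul]; ring)

theorem modelCurv_apply (p : ℕ) (x y z w : R2p p) :
    modelCurv p ![x, y, z, w] = (x.1 ⬝ᵥ w.1) * (y.1 ⬝ᵥ z.1) - (x.1 ⬝ᵥ z.1) * (y.1 ⬝ᵥ w.1) := rfl

/-- The model `U_{1,p} = (ℝ^{2p}, g_{1,p}, A_{1,p})`, whose non-zero components are
`g_{1,p}(Xᵢ, Yᵢ) = 1` and `A_{1,p}(Xᵢ, Xⱼ, X_k, X_l) = δ_il δ_jk - δ_ik δ_jl`. -/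
def model1 (p : ℕ) : ZeroModel (R2p p) where
  g := neutralForm 0
  g_symm := neutralForm_symm 0
  g_nondeg := neutralForm_nondegenerate 0
  A := modelCurv p
  A_antisymm x y z w := by simp only [modelCurv_apply]; ring
  A_pair x y z w := by
    simp only [modelCurv_apply, dotProduct_comm z.1, dotProduct_comm w.1]; ring
  A_bianchi x y z w := by
    simp only [modelCurv_apply, dotProduct_comm z.1 x.1, dotProduct_comm z.1 y.1,
      dotProduct_comm y.1 x.1]
    ring

/-- The function `α₁` on `ℝ^{2p}`: the square norm of `∇R` restricted to the `∂ˣ` directions, all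
indices being raised with the inverse `H_f^{ij}` of the Hessian. -/
def alpha1 {p : ℕ} (f : (Fin p → ℝ) → ℝ) (hf : ContDiff ℝ ∞ f) (P : R2p p) : ℝ :=
  ∑ a, ∑ b, ∑ c, ∑ d, ∑ e, ∑ s, ∑ t, ∑ u, ∑ v, ∑ w,
    (hess f P.1)⁻¹ a s * (hess f P.1)⁻¹ b t * (hess f P.1)⁻¹ c u * (hess f P.1)⁻¹ d v
      * (hess f P.1)⁻¹ e w
      * (metric1 f hf).covCurv P (dx a) (dx b) (dx c) (dx d) (dx e)
      * (metric1 f hf).covCurv P (dx s) (dx t) (dx u) (dx v) (dx w)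

end

noncomputable section

/-! ### Second derivatives of smooth functions -/

/-! Everything rests on `christoffel_metric1`: Γ(u, v) = (0, H(u, v) ∇f). It sees only x-components
and takes values in the null y-directions. Hence no Γ∘Γ term survives in R, and the third
derivatives of f cancel by symmetry, leaving the 2 × 2 minors of H. The corrections in ∇R vanish
because R kills y-directions.

The geodesic equation becomes x'' = 0, y'' = -H(x', x') ∇f(x). It is solved by two integrations for
all time, and exp_P is a translation followed by a shear, hence a diffeomorphism.

For the 0-model, write H = BᵀB: acting by B on x and by the inverse transpose on y normalises R,
once a shear in y has removed the square of df from the metric (`isZeroModel_metric1`). A splitting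
of the model makes every x-part from one summand proportional to every x-part from the other, which
for p ≥ 2 forces one summand to be zero (`eq_bot_or_eq_bot_of_neutralForm`). For f = |x|² the same
relation follows from parallel transport around one explicit loop, and the geodesic symmetries are
explicit quadratic maps.

For p ≥ 3 a positive definite form is determined by its 2 × 2 minors (`bilinForm_eq_of_minors_eq`).
An isomorphism of 1-models between two tangent spaces therefore induces on x-components a map
preserving H and ∇R, so it preserves `alpha1`, the square norm of ∇R with respect to H. -/

theorem fderiv_fderiv_apply_comm {E F : Type*} [NormedAddCommGroup E] [NormedSpace ℝ E]
    [NormedAddCommGroup F] [NormedSpace ℝ F] {φ : E → F} (hφ : ContDiff ℝ ∞ φ) (x u v : E) :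
    fderiv ℝ (fun y => fderiv ℝ φ y v) x u = fderiv ℝ (fun y => fderiv ℝ φ y u) x v := by
  have hd : DifferentiableAt ℝ (fderiv ℝ φ) x :=
    ((hφ.fderiv_right (m := ∞) (by simp)).differentiable (by simp)) x
  have key : ∀ a b, fderiv ℝ (fun y => fderiv ℝ φ y b) x a = fderiv ℝ (fderiv ℝ φ) x a b := by
    intro a b
    rw [fderiv_clm_apply hd (differentiableAt_const b)]
    simp
  rw [key, key]
  have h2 : minSmoothness ℝ 2 ≤ (∞ : WithTop ℕ∞) := by
    rw [minSmoothness_of_isRCLikeNormedField]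
    exact WithTop.coe_le_coe.2 (le_top : (2 : ℕ∞) ≤ ⊤)
  exact (hφ.contDiffAt.isSymmSndFDerivAt h2) u v

/-! ### The gradient and the Hessian form of f. -/

section Gradient

variable {p : ℕ} {f : (Fin p → ℝ) → ℝ}

def grad (f : (Fin p → ℝ) → ℝ) (x : Fin p → ℝ) : Fin p → ℝ := fun i => pderiv i f x

/-- The Hessian as a bilinear form. -/
def hessForm (f : (Fin p → ℝ) → ℝ) (x u v : Fin p → ℝ) : ℝ := u ⬝ᵥ (hess f x).mulVec v

theorem contDiff_grad (hf : ContDiff ℝ ∞ f) : ContDiff ℝ ∞ (grad f) :=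
  contDiff_pi.2 (contDiff_pderiv hf)

theorem hess_symm (hf : ContDiff ℝ ∞ f) (x : Fin p → ℝ) (i j : Fin p) :
    hess f x i j = hess f x j i :=
  fderiv_fderiv_apply_comm hf x _ _

theorem hess_isSymm (hf : ContDiff ℝ ∞ f) (x : Fin p → ℝ) : (hess f x).IsSymm :=
  Matrix.IsSymm.ext fun i j => hess_symm hf x j i

theorem hessForm_symm (hf : ContDiff ℝ ∞ f) (x u v : Fin p → ℝ) :
    hessForm f x u v = hessForm f x v u := by
  unfold hessForm
  rw [dotProduct_comm, Matrix.dotProduct_mulVec, ← Matrix.mulVec_transpose,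
    (hess_isSymm hf x).eq, dotProduct_comm, dotProduct_comm]

theorem hessForm_single (x : Fin p → ℝ) (i j : Fin p) :
    hessForm f x (Pi.single i 1) (Pi.single j 1) = hess f x i j := by
  simp [hessForm]

@[simp] theorem hessForm_zero_left (x v : Fin p → ℝ) : hessForm f x 0 v = 0 := by
  simp [hessForm]

@[simp] theorem hessForm_zero_right (x v : Fin p → ℝ) : hessForm f x v 0 = 0 := by
  simp [hessForm]

theorem differentiable_grad (hf : ContDiff ℝ ∞ f) : Differentiable ℝ (grad f) :=
  (contDiff_grad hf).differentiable (by simp)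

theorem fderiv_grad_apply (hf : ContDiff ℝ ∞ f) (x u : Fin p → ℝ) :
    fderiv ℝ (grad f) x u = (hess f x).mulVec u := by
  ext i
  have h1 : fderiv ℝ (grad f) x u i = fderiv ℝ (pderiv i f) x u := by
    have := (hasFDerivAt_pi'.1 ((differentiable_grad hf) x).hasFDerivAt i).fderiv
    change _ = fderiv ℝ (fun x => grad f x i) x u
    rw [this]; rfl
  rw [h1]
  conv_lhs => rw [pi_eq_sum_univ' u]
  rw [map_sum]
  simp only [Matrix.mulVec, dotProduct]
  refine Finset.sum_congr rfl fun j _ => ?_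
  rw [map_smul, hess_symm hf x i j, smul_eq_mul, mul_comm]
  congr 1

theorem contDiff_dotProduct_left {E : Type*} [NormedAddCommGroup E] [NormedSpace ℝ E]
    {F G : E → Fin p → ℝ} (hF : ContDiff ℝ ∞ F) (hG : ContDiff ℝ ∞ G) :
    ContDiff ℝ ∞ fun y => F y ⬝ᵥ G y := by
  simp only [dotProduct]
  exact ContDiff.sum fun i _ => (contDiff_pi.1 hF i).mul (contDiff_pi.1 hG i)

theorem fderiv_dotProduct_const {E : Type*} [NormedAddCommGroup E] [NormedSpace ℝ E]
    {F : E → Fin p → ℝ} {x : E} (hF : DifferentiableAt ℝ F x) (c : Fin p → ℝ) (u : E) :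
    fderiv ℝ (fun y => F y ⬝ᵥ c) x u = fderiv ℝ F x u ⬝ᵥ c := by
  simp only [dotProduct]
  rw [fderiv_fun_sum fun i _ => ((differentiableAt_pi.1 hF i).mul_const _)]
  simp only [sum_apply]
  refine Finset.sum_congr rfl fun i _ => ?_
  rw [fderiv_mul_const (differentiableAt_pi.1 hF i), fderiv_apply hF]
  simp [mul_comm]

theorem hessForm_eq_fderiv (hf : ContDiff ℝ ∞ f) (x u v : Fin p → ℝ) :
    hessForm f x u v = fderiv ℝ (fun y => grad f y ⬝ᵥ u) x v := by
  rw [fderiv_dotProduct_const (differentiable_grad hf x), fderiv_grad_apply hf, hessForm,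
    dotProduct_comm]

theorem contDiff_hessForm (hf : ContDiff ℝ ∞ f) (u v : Fin p → ℝ) :
    ContDiff ℝ ∞ fun x => hessForm f x u v := by
  simp only [hessForm_eq_fderiv hf]
  exact ((contDiff_dotProduct_left (contDiff_grad hf) contDiff_const).fderiv_right
    (m := ∞) (by simp)).clm_apply contDiff_const

/-- Symmetry of the third derivative of f; this is what cancels the derivatives of H in the
curvature. -/
theorem fderiv_hessForm_comm (hf : ContDiff ℝ ∞ f) (x u v w : Fin p → ℝ) :
    fderiv ℝ (fun y => hessForm f y v w) x u = fderiv ℝ (fun y => hessForm f y u w) x v := by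
  simp only [hessForm_symm hf _ _ w]
  simp only [hessForm_eq_fderiv hf]
  exact fderiv_fderiv_apply_comm
    (contDiff_dotProduct_left (contDiff_grad hf) contDiff_const) x u v

theorem fderiv_comp_fst {E F G : Type*} [NormedAddCommGroup E] [NormedSpace ℝ E]
    [NormedAddCommGroup F] [NormedSpace ℝ F] [NormedAddCommGroup G] [NormedSpace ℝ G]
    {φ : E → G} (P u : E × F) (hφ : DifferentiableAt ℝ φ P.1) :
    fderiv ℝ (fun Q : E × F => φ Q.1) P u = fderiv ℝ φ P.1 u.1 := by
  have h := hφ.hasFDerivAt.comp P (hasFDerivAt_fst (𝕜 := ℝ) (p := P))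
  exact congrArg (fun L => L u) h.fderiv

end Gradient

/-! ### The Levi-Civita connection and the curvature of `g_{1,p,f}` -/

section Curvature

variable {p : ℕ} {f : (Fin p → ℝ) → ℝ}

theorem neutralForm_eq_dotProduct (a : Fin p → ℝ) (u v : R2p p) :
    neutralForm a u v = (a ⬝ᵥ u.1) * (a ⬝ᵥ v.1) + (u.1 ⬝ᵥ v.2 + u.2 ⬝ᵥ v.1) := by
  simp [neutralForm_apply, dotProduct, Finset.sum_add_distrib]

theorem metric1_val (hf : ContDiff ℝ ∞ f) (P u v : R2p p) :
    (metric1 f hf).val P u v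
      = (grad f P.1 ⬝ᵥ u.1) * (grad f P.1 ⬝ᵥ v.1) + (u.1 ⬝ᵥ v.2 + u.2 ⬝ᵥ v.1) :=
  neutralForm_eq_dotProduct _ u v

theorem fderiv_metric1 (hf : ContDiff ℝ ∞ f) (P u v w : R2p p) :
    fderiv ℝ (fun Q => (metric1 f hf).val Q v w) P u
      = hessForm f P.1 u.1 v.1 * (grad f P.1 ⬝ᵥ w.1)
        + (grad f P.1 ⬝ᵥ v.1) * hessForm f P.1 u.1 w.1 := by
  simp only [metric1_val]
  have hd : ∀ c : Fin p → ℝ, Differentiable ℝ fun x => grad f x ⬝ᵥ c := fun c =>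
    (contDiff_dotProduct_left (contDiff_grad hf) contDiff_const).differentiable (by simp)
  rw [fderiv_add_const, fderiv_comp_fst (φ := fun x => grad f x ⬝ᵥ v.1 * grad f x ⬝ᵥ w.1) P u
    (((hd v.1).mul (hd w.1)) P.1), fderiv_fun_mul (hd v.1 P.1) (hd w.1 P.1)]
  simp only [add_apply, smul_apply, smul_eq_mul,
    ← hessForm_eq_fderiv hf, hessForm_symm hf P.1 u.1]
  ring

/-- The Koszul functional collapses to w ↦ H(u, v) df(w). It involves only the x-part of w, so its
metric dual is a pure y-vector. -/
theorem christoffel_metric1 (hf : ContDiff ℝ ∞ f) (P u v : R2p p) :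
    (metric1 f hf).christoffel P u v = (0, hessForm f P.1 u.1 v.1 • grad f P.1) := by
  unfold PseudoRiemannianMetric.christoffel
  rw [LinearEquiv.symm_apply_eq]
  refine LinearMap.ext fun w => ?_
  rw [LinearMap.BilinForm.toDual_def, metric1_val]
  change (1 / 2 : ℝ) * _ = _
  rw [fderiv_metric1, fderiv_metric1, fderiv_metric1, hessForm_symm hf P.1 v.1 u.1,
    hessForm_symm hf P.1 w.1 u.1, hessForm_symm hf P.1 w.1 v.1]
  simp
  ring

theorem curvOp_metric1 (hf : ContDiff ℝ ∞ f) (P u v w : R2p p) :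
    (metric1 f hf).curvOp P u v w = (0, hessForm f P.1 v.1 w.1 • (hess f P.1).mulVec u.1
      - hessForm f P.1 u.1 w.1 • (hess f P.1).mulVec v.1) := by
  have h1 : ∀ a b : R2p p, (metric1 f hf).covDeriv (fun _ => a) (fun _ => b)
      = fun Q => ((0 : Fin p → ℝ), hessForm f Q.1 a.1 b.1 • grad f Q.1) := by
    intro a b
    funext Q
    simp [PseudoRiemannianMetric.covDeriv, christoffel_metric1]
  have h2 : ∀ a b c : R2p p, (metric1 f hf).covDeriv (fun _ => c)
      ((metric1 f hf).covDeriv (fun _ => a) (fun _ => b)) P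
      = (0, fderiv ℝ (fun x => hessForm f x a.1 b.1) P.1 c.1 • grad f P.1
        + hessForm f P.1 a.1 b.1 • (hess f P.1).mulVec c.1) := by
    intro a b c
    have hh := ((contDiff_hessForm hf a.1 b.1).differentiable (by simp)) P.1
    have hg := differentiable_grad hf P.1
    rw [h1, PseudoRiemannianMetric.covDeriv, christoffel_metric1,
      fderiv_comp_fst (φ := fun x => ((0 : Fin p → ℝ), hessForm f x a.1 b.1 • grad f x)) P c
      ((differentiableAt_const _).prodMk (hh.fun_smul hg)),
      DifferentiableAt.fderiv_prodMk (differentiableAt_const _) (hh.fun_smul hg),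
      fderiv_fun_smul hh hg]
    simp [fderiv_grad_apply hf, add_comm]
  rw [PseudoRiemannianMetric.curvOp, h2, h2, fderiv_hessForm_comm hf P.1 u.1]
  ext i <;> simp

theorem curv_metric1 (hf : ContDiff ℝ ∞ f) (P x y z w : R2p p) :
    (metric1 f hf).curv P x y z w = hessForm f P.1 x.1 w.1 * hessForm f P.1 y.1 z.1
      - hessForm f P.1 x.1 z.1 * hessForm f P.1 y.1 w.1 := by
  rw [PseudoRiemannianMetric.curv, curvOp_metric1, metric1_val, hessForm_symm hf _ x.1 w.1,
    hessForm_symm hf _ y.1 w.1]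
  simp [hessForm, dotProduct_comm _ w.1]
  ring

/-- Each correction term inserts a Christoffel vector into R; that vector has no x-part, so R
vanishes on it. -/
theorem covCurv_metric1 (hf : ContDiff ℝ ∞ f) (P x y z w v : R2p p) :
    (metric1 f hf).covCurv P x y z w v
      = fderiv ℝ (fun Q => (metric1 f hf).curv Q x y z w) P v := by
  simp [PseudoRiemannianMetric.covCurv, curv_metric1, christoffel_metric1]

/-- The derivative, in the direction `v`, of the curvature as a function on `ℝ^p`. -/
def hessCurvDeriv (f : (Fin p → ℝ) → ℝ) (a x y z w v : Fin p → ℝ) : ℝ :=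
  fderiv ℝ (fun b => hessForm f b x w * hessForm f b y z - hessForm f b x z * hessForm f b y w) a v

theorem covCurv_metric1_eq_hessCurvDeriv (hf : ContDiff ℝ ∞ f) (P x y z w v : R2p p) :
    (metric1 f hf).covCurv P x y z w v = hessCurvDeriv f P.1 x.1 y.1 z.1 w.1 v.1 := by
  rw [covCurv_metric1]
  simp only [curv_metric1]
  have h := fun a b => (contDiff_hessForm hf a b).differentiable (by simp : (∞ : WithTop ℕ∞) ≠ 0)
  exact fderiv_comp_fst (φ := fun b => hessForm f b x.1 w.1 * hessForm f b y.1 z.1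
    - hessForm f b x.1 z.1 * hessForm f b y.1 w.1) P v
    (((h _ _).mul (h _ _)).sub ((h _ _).mul (h _ _)) P.1)

theorem curv_metric1_dx (hf : ContDiff ℝ ∞ f) (P : R2p p) (i j k l : Fin p) :
    (metric1 f hf).curv P (dx i) (dx j) (dx k) (dx l)
      = hess f P.1 i l * hess f P.1 j k - hess f P.1 i k * hess f P.1 j l := by
  simp only [curv_metric1, coordVec, hessForm_single]

theorem coordVec_fst_of_isRight {s : Fin p ⊕ Fin p} (h : s.isRight) :
    (coordVec s : R2p p).1 = 0 := by
  obtain ⟨i, rfl⟩ := Sum.isRight_iff.1 h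
  rfl

theorem curv_metric1_coordVec (hf : ContDiff ℝ ∞ f) (P : R2p p) (a : Fin 4 → Fin p ⊕ Fin p)
    (h : ∃ m, (a m).isRight) :
    (metric1 f hf).curv P (coordVec (a 0)) (coordVec (a 1)) (coordVec (a 2)) (coordVec (a 3))
      = 0 := by
  obtain ⟨m, hm⟩ := h
  have := coordVec_fst_of_isRight hm
  rw [curv_metric1]
  fin_cases m <;> simp_all

theorem covCurv_metric1_coordVec (hf : ContDiff ℝ ∞ f) (P : R2p p) (a : Fin 5 → Fin p ⊕ Fin p)
    (h : ∃ m, (a m).isRight) :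
    (metric1 f hf).covCurv P (coordVec (a 0)) (coordVec (a 1)) (coordVec (a 2)) (coordVec (a 3))
      (coordVec (a 4)) = 0 := by
  obtain ⟨m, hm⟩ := h
  have := coordVec_fst_of_isRight hm
  rw [covCurv_metric1_eq_hessCurvDeriv, hessCurvDeriv]
  fin_cases m <;> simp_all

end Curvature

/-! ### Signature -/

theorem dotProduct_self_pos {ι : Type*} [Fintype ι] {u : ι → ℝ} (hu : u ≠ 0) : 0 < u ⬝ᵥ u :=
  lt_of_le_of_ne (Finset.sum_nonneg fun i _ => mul_self_nonneg (u i))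
    fun h => hu (dotProduct_self_eq_zero.1 h.symm)

/-- The term -½(a·u)a in the y-slot cancels the square (a·u)², so on the graph of u ↦ cu - ½(a·u)a
the form is 2c|u|². Taking c = ±1 gives definite subspaces of dimension p of both signs, and these
exhaust the dimension 2p. -/
theorem hasSignature_neutralForm {p : ℕ} (a : Fin p → ℝ) : HasSignature (neutralForm a) p p := by
  let L : ℝ → (Fin p → ℝ) →ₗ[ℝ] R2p p := fun c =>
    LinearMap.prod LinearMap.id
      (c • LinearMap.id - (1 / 2 : ℝ) • (dotProductBilin ℝ ℝ a).smulRight a)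
  have hL : ∀ c u, neutralForm a (L c u) (L c u) = 2 * c * (u ⬝ᵥ u) := by
    intro c u
    rw [neutralForm_eq_dotProduct]
    simp [L, dotProduct_comm u a]
    ring
  have hrank : ∀ c, Module.finrank ℝ (LinearMap.range (L c)) = p := by
    intro c
    rw [LinearMap.finrank_range_of_inj]
    · simp
    · intro u v h
      exact congrArg Prod.fst h
  have hpos : p ≤ sigPos (neutralForm a).toQuadraticMap := by
    refine (hrank 1).symm.le.trans (le_sigPos_of_posDef _ ?_)
    rintro ⟨_, u, rfl⟩ hu
    change 0 < neutralForm a (L 1 u) (L 1 u)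
    rw [hL]
    have : u ≠ 0 := by rintro rfl; simp at hu
    have := dotProduct_self_pos this
    linarith
  have hneg : p ≤ sigNeg (neutralForm a).toQuadraticMap := by
    refine (hrank (-1)).symm.le.trans (le_sigNeg_of_negDef _ ?_)
    rintro ⟨_, u, rfl⟩ hu
    change 0 < - neutralForm a (L (-1) u) (L (-1) u)
    rw [hL]
    have : u ≠ 0 := by rintro rfl; simp at hu
    have := dotProduct_self_pos this
    linarith
  have h := QuadraticForm.sigPos_add_sigNeg_add_radical (Q := (neutralForm a).toQuadraticMap)
  have h2 : Module.finrank ℝ (R2p p) = p + p := by simp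
  constructor <;> omega

/-! ### Integrals depending smoothly on parameters -/

section Integrals

open MeasureTheory

/-- The integral is the value at 0 of the convolution of the indicator of (0, 1] with x ↦ χ(x) g(q,
-x). The bump χ equals 1 where the indicator lives and supplies the compact support that smoothness
of parametrised convolutions requires. -/
theorem contDiff_integral_param {E F : Type*} [NormedAddCommGroup E] [NormedSpace ℝ E]
    [NormedAddCommGroup F] [NormedSpace ℝ F] {g : E × ℝ → F} (hg : ContDiff ℝ ∞ g) :
    ContDiff ℝ ∞ fun q => ∫ s in (0 : ℝ)..1, g (q, s) := by
  let χ : ContDiffBump (0 : ℝ) := ⟨2, 3, by norm_num, by norm_num⟩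
  have hloc : LocallyIntegrable (Set.indicator (Set.Ioc (0 : ℝ) 1) (fun _ => (1 : ℝ))) volume :=
    (locallyIntegrable_const 1).indicator measurableSet_Ioc
  have h := contDiffOn_convolution_right_with_param_comp (n := ⊤) (μ := (volume : Measure ℝ))
    (ContinuousLinearMap.lsmul ℝ ℝ : ℝ →L[ℝ] F →L[ℝ] F) (s := (Set.univ : Set E))
    (v := fun _ => (0 : ℝ)) (g := fun q x => χ x • g (q, -x)) (k := Metric.closedBall 0 3)
    contDiffOn_const isOpen_univ (isCompact_closedBall 0 3)
    (fun q x _ hx => by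
      rw [χ.zero_of_le_dist (le_of_lt (by simpa using hx)), zero_smul]) hloc
    (ContDiff.contDiffOn
      ((χ.contDiff.comp contDiff_snd).smul (hg.comp (contDiff_fst.prodMk contDiff_snd.neg))))
  rw [contDiffOn_univ] at h
  convert h using 2 with q
  rw [convolution_def, intervalIntegral.integral_of_le zero_le_one,
    ← integral_indicator measurableSet_Ioc]
  refine integral_congr_ae (Filter.Eventually.of_forall fun t => ?_)
  by_cases ht : t ∈ Set.Ioc (0 : ℝ) 1
  · have : χ (0 - t) = 1 := χ.one_of_mem_closedBall (by
      simp only [Metric.mem_closedBall, dist_zero_right, Real.norm_eq_abs, zero_sub, abs_neg]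
      rw [abs_of_pos ht.1]
      exact ht.2.trans one_le_two)
    rw [zero_sub] at this
    simp [ht, this]
  · simp [ht]

variable {E : Type*} [NormedAddCommGroup E] [NormedSpace ℝ E]

theorem hasDerivAt_primitive [CompleteSpace E] {F : ℝ → E} (hF : Continuous F) (t : ℝ) :
    HasDerivAt (fun t => ∫ r in (0 : ℝ)..t, F r) (F t) t :=
  (hF.integral_hasStrictDerivAt 0 t).hasDerivAt

theorem contDiff_primitive [CompleteSpace E] {F : ℝ → E} (hF : ContDiff ℝ ∞ F) :
    ContDiff ℝ ∞ fun t => ∫ r in (0 : ℝ)..t, F r := by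
  have h := hasDerivAt_primitive hF.continuous
  rw [contDiff_infty_iff_deriv]
  refine ⟨fun t => (h t).differentiableAt, ?_⟩
  rwa [funext fun t => (h t).deriv]

/-- The solution of `L'' = F`, `L(0) = L'(0) = 0`. -/
def doublePrimitive (F : ℝ → E) (t : ℝ) : E :=
  t • (∫ r in (0 : ℝ)..t, F r) - ∫ r in (0 : ℝ)..t, r • F r

theorem hasDerivAt_doublePrimitive [CompleteSpace E] {F : ℝ → E} (hF : Continuous F) (t : ℝ) :
    HasDerivAt (doublePrimitive F) (∫ r in (0 : ℝ)..t, F r) t := by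
  have h := ((hasDerivAt_id t).fun_smul (hasDerivAt_primitive hF t)).fun_sub
    (hasDerivAt_primitive (F := fun r => r • F r) (continuous_id.smul hF) t)
  refine h.congr_deriv ?_
  simp

theorem contDiff_doublePrimitive [CompleteSpace E] {F : ℝ → E} (hF : ContDiff ℝ ∞ F) :
    ContDiff ℝ ∞ (doublePrimitive F) :=
  (contDiff_id.smul (contDiff_primitive hF)).sub (contDiff_primitive (contDiff_id.smul hF))

theorem doublePrimitive_one {F : ℝ → E} (hF : Continuous F) :
    doublePrimitive F 1 = ∫ r in (0 : ℝ)..1, (1 - r) • F r := by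
  have h : Continuous fun r => r • F r := continuous_id.smul hF
  rw [doublePrimitive, one_smul, ← intervalIntegral.integral_sub (hF.intervalIntegrable 0 1)
    (h.intervalIntegrable 0 1)]
  simp [sub_smul]

end Integrals

/-! ### Geodesics of `g_{1,p,f}` -/

section Geodesics

variable {p : ℕ} {f : (Fin p → ℝ) → ℝ}

theorem contDiff_hessForm_comp (hf : ContDiff ℝ ∞ f) {E : Type*} [NormedAddCommGroup E]
    [NormedSpace ℝ E] {a b c : E → Fin p → ℝ} (ha : ContDiff ℝ ∞ a) (hb : ContDiff ℝ ∞ b)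
    (hc : ContDiff ℝ ∞ c) : ContDiff ℝ ∞ fun y => hessForm f (a y) (b y) (c y) := by
  refine contDiff_dotProduct_left hb (contDiff_pi.2 fun i => ?_)
  refine contDiff_dotProduct_left (contDiff_pi.2 fun j => ?_) hc
  exact (contDiff_pderiv (contDiff_pderiv hf j) i).comp ha

/-- The second derivative of the `y`-coordinates of a geodesic is `-geodesicForce f x x'`. -/
def geodesicForce (f : (Fin p → ℝ) → ℝ) (x a : Fin p → ℝ) : Fin p → ℝ :=
  hessForm f x a a • grad f x

theorem contDiff_geodesicForce_comp (hf : ContDiff ℝ ∞ f) {E : Type*} [NormedAddCommGroup E]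
    [NormedSpace ℝ E] {a b : E → Fin p → ℝ} (ha : ContDiff ℝ ∞ a) (hb : ContDiff ℝ ∞ b) :
    ContDiff ℝ ∞ fun y => geodesicForce f (a y) (b y) :=
  (contDiff_hessForm_comp hf ha hb hb).smul ((contDiff_grad hf).comp ha)

/-- The double primitive of the force at time 1, in Cauchy's form with kernel 1 - s. The limits are
fixed, so smoothness in a follows from `contDiff_integral_param`. -/
def expShift (f : (Fin p → ℝ) → ℝ) (x a : Fin p → ℝ) : Fin p → ℝ :=
  ∫ s in (0 : ℝ)..1, (1 - s) • geodesicForce f (x + s • a) a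

theorem contDiff_expShift (hf : ContDiff ℝ ∞ f) (x : Fin p → ℝ) :
    ContDiff ℝ ∞ (expShift f x) :=
  contDiff_integral_param (g := fun q => (1 - q.2) • geodesicForce f (x + q.2 • q.1) q.1)
    ((contDiff_const.sub contDiff_snd).smul (contDiff_geodesicForce_comp hf
      (contDiff_const.add (contDiff_snd.smul contDiff_fst)) contDiff_fst))

/-- The exponential map of `g_{1,p,f}` at `P`. -/
def expDiffeomorph (hf : ContDiff ℝ ∞ f) (P : R2p p) :
    R2p p ≃ₘ^∞⟮𝓘(ℝ, R2p p), 𝓘(ℝ, R2p p)⟯ R2p p where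
  toFun v := (P.1 + v.1, P.2 + v.2 - expShift f P.1 v.1)
  invFun Q := (Q.1 - P.1, Q.2 - P.2 + expShift f P.1 (Q.1 - P.1))
  left_inv v := by ext i <;> simp; ring
  right_inv Q := by ext i <;> simp; ring
  contMDiff_toFun := ContDiff.contMDiff ((contDiff_const.add contDiff_fst).prodMk
    ((contDiff_const.add contDiff_snd).sub ((contDiff_expShift hf P.1).comp contDiff_fst)))
  contMDiff_invFun := ContDiff.contMDiff ((contDiff_fst.sub contDiff_const).prodMk
    ((contDiff_snd.sub contDiff_const).add
      ((contDiff_expShift hf P.1).comp (contDiff_fst.sub contDiff_const))))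

/-- The geodesic with initial position `P` and initial velocity `v`. -/
def geodesic (f : (Fin p → ℝ) → ℝ) (P v : R2p p) (t : ℝ) : R2p p :=
  (P.1 + t • v.1,
    P.2 + t • v.2 - doublePrimitive (fun r => geodesicForce f (P.1 + r • v.1) v.1) t)

theorem contDiff_geodesicForce_line (hf : ContDiff ℝ ∞ f) (x a : Fin p → ℝ) :
    ContDiff ℝ ∞ fun r : ℝ => geodesicForce f (x + r • a) a :=
  contDiff_geodesicForce_comp hf (contDiff_const.add (contDiff_id.smul contDiff_const))
    contDiff_const

theorem contDiff_geodesic (hf : ContDiff ℝ ∞ f) (P v : R2p p) :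
    ContDiff ℝ ∞ (geodesic f P v) :=
  (contDiff_const.add (contDiff_id.smul contDiff_const)).prodMk
    ((contDiff_const.add (contDiff_id.smul contDiff_const)).sub
      (contDiff_doublePrimitive (contDiff_geodesicForce_line hf P.1 v.1)))

theorem deriv_geodesic (hf : ContDiff ℝ ∞ f) (P v : R2p p) :
    deriv (geodesic f P v) = fun t =>
      (v.1, v.2 - ∫ r in (0 : ℝ)..t, geodesicForce f (P.1 + r • v.1) v.1) := by
  funext t
  have hlin : ∀ a b : Fin p → ℝ, HasDerivAt (fun t : ℝ => a + t • b) b t := fun a b => by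
    simpa using ((hasDerivAt_id t).smul_const b).const_add a
  exact ((hlin P.1 v.1).prodMk ((hlin P.2 v.2).sub
    (hasDerivAt_doublePrimitive (contDiff_geodesicForce_line hf P.1 v.1).continuous t))).deriv

theorem deriv_deriv_geodesic (hf : ContDiff ℝ ∞ f) (P v : R2p p) (t : ℝ) :
    deriv (deriv (geodesic f P v)) t = (0, -geodesicForce f (P.1 + t • v.1) v.1) := by
  rw [deriv_geodesic hf]
  exact ((hasDerivAt_const t v.1).prodMk ((hasDerivAt_primitive
    (contDiff_geodesicForce_line hf P.1 v.1).continuous t).const_sub v.2)).deriv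

theorem geodesic_zero (P v : R2p p) : geodesic f P v 0 = P := by
  simp [geodesic, doublePrimitive]

theorem deriv_geodesic_zero (hf : ContDiff ℝ ∞ f) (P v : R2p p) :
    deriv (geodesic f P v) 0 = v := by
  simp [deriv_geodesic hf]

theorem geodesic_one (hf : ContDiff ℝ ∞ f) (P v : R2p p) :
    geodesic f P v 1 = expDiffeomorph hf P v := by
  simp only [geodesic,
    doublePrimitive_one (contDiff_geodesicForce_line hf P.1 v.1).continuous, one_smul]
  rfl

theorem isGeodesicOn_geodesic_sub (hf : ContDiff ℝ ∞ f) (P v : R2p p) (t₀ : ℝ) :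
    (metric1 f hf).IsGeodesicOn (fun t => geodesic f P v (t - t₀)) Set.univ := by
  refine ⟨((contDiff_geodesic hf P v).comp (contDiff_id.sub contDiff_const)).contDiffOn,
    fun t _ => ?_⟩
  have h : deriv (fun t => geodesic f P v (t - t₀)) = fun t => deriv (geodesic f P v) (t - t₀) :=
    funext fun t => deriv_comp_sub_const _ _ _
  rw [h, deriv_comp_sub_const, deriv_deriv_geodesic hf, christoffel_metric1, deriv_geodesic hf]
  simp [geodesic, geodesicForce]

theorem isGeodesicOn_geodesic (hf : ContDiff ℝ ∞ f) (P v : R2p p) :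
    (metric1 f hf).IsGeodesicOn (geodesic f P v) Set.univ := by
  simpa using isGeodesicOn_geodesic_sub hf P v 0

theorem eqOn_of_deriv_deriv_eq {E : Type*} [NormedAddCommGroup E] [NormedSpace ℝ E] {I : Set ℝ}
    (hI : IsOpen I) (hc : I.OrdConnected) {u w : ℝ → E} (hu : ContDiffOn ℝ ∞ u I)
    (hw : ContDiffOn ℝ ∞ w I) (h : ∀ t ∈ I, deriv (deriv u) t = deriv (deriv w) t) {t₀ : ℝ}
    (ht₀ : t₀ ∈ I) (h0 : u t₀ = w t₀) (h1 : deriv u t₀ = deriv w t₀) : Set.EqOn u w I := by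
  have hd : ∀ {z : ℝ → E}, ContDiffOn ℝ ∞ z I → DifferentiableOn ℝ (deriv z) I := fun hz =>
    (hz.deriv_of_isOpen (m := ∞) hI (by simp)).differentiableOn (by simp)
  have hp := hc.isPreconnected
  refine hI.eqOn_of_deriv_eq hp (hu.differentiableOn (by simp)) (hw.differentiableOn (by simp))
    ?_ ht₀ h0
  exact hI.eqOn_of_deriv_eq hp (hd hu) (hd hw) h ht₀ h1

/-- No ODE theory is needed: the x-parts have zero second derivative, so they agree. The second
derivatives of the full curves are then the same function of time, and two integrations finish. -/
theorem eqOn_of_isGeodesicOn (hf : ContDiff ℝ ∞ f) {I : Set ℝ} (hI : IsOpen I)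
    (hc : I.OrdConnected) {γ σ : ℝ → R2p p} (hγ : (metric1 f hf).IsGeodesicOn γ I)
    (hσ : (metric1 f hf).IsGeodesicOn σ I) {t₀ : ℝ} (ht₀ : t₀ ∈ I) (h0 : γ t₀ = σ t₀)
    (h1 : deriv γ t₀ = deriv σ t₀) : Set.EqOn γ σ I := by
  have hfst : ∀ {u : ℝ → R2p p} {t : ℝ}, DifferentiableAt ℝ u t →
      deriv (fun t => (u t).1) t = (deriv u t).1 := fun hu =>
    ((ContinuousLinearMap.fst ℝ (Fin p → ℝ) (Fin p → ℝ)).hasFDerivAt.comp_hasDerivAt _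
      hu.hasDerivAt).deriv
  have hd : ∀ {u : ℝ → R2p p}, ContDiffOn ℝ ∞ u I → ∀ t ∈ I, DifferentiableAt ℝ u t :=
    fun hu t ht => (hu.differentiableOn (by simp)).differentiableAt (hI.mem_nhds ht)
  have hfst2 : ∀ {u : ℝ → R2p p}, (metric1 f hf).IsGeodesicOn u I → ∀ t ∈ I,
      deriv (deriv fun t => (u t).1) t = 0 := by
    intro u hu t ht
    have he : deriv (fun t => (u t).1) =ᶠ[nhds t] fun t => (deriv u t).1 := by
      filter_upwards [hI.mem_nhds ht] with s hs using hfst (hd hu.1 s hs)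
    rw [he.deriv_eq,
      hfst (hd (hu.1.deriv_of_isOpen (m := ∞) hI (by simp)) t ht)]
    have := congrArg Prod.fst (hu.2 t ht)
    simpa [christoffel_metric1] using this
  have hx : Set.EqOn (fun t => (γ t).1) (fun t => (σ t).1) I :=
    eqOn_of_deriv_deriv_eq hI hc (contDiff_fst.comp_contDiffOn hγ.1)
      (contDiff_fst.comp_contDiffOn hσ.1)
      (fun t ht => by rw [hfst2 hγ t ht, hfst2 hσ t ht]) ht₀ (congrArg Prod.fst h0)
      (by rw [hfst (hd hγ.1 _ ht₀), hfst (hd hσ.1 _ ht₀), h1])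
  refine eqOn_of_deriv_deriv_eq hI hc hγ.1 hσ.1 (fun t ht => ?_) ht₀ h0 h1
  have hx' : (deriv γ t).1 = (deriv σ t).1 := by
    rw [← hfst (hd hγ.1 t ht), ← hfst (hd hσ.1 t ht)]
    exact (hx.eventuallyEq_of_mem (hI.mem_nhds ht)).deriv_eq
  have e1 := hγ.2 t ht
  have e2 := hσ.2 t ht
  rw [christoffel_metric1] at e1 e2
  rw [eq_neg_of_add_eq_zero_left e1, eq_neg_of_add_eq_zero_left e2, hx',
    show (γ t).1 = (σ t).1 from hx ht]

theorem isGeodesicallyComplete_metric1 (hf : ContDiff ℝ ∞ f) :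
    (metric1 f hf).IsGeodesicallyComplete := by
  intro I γ hI hc ⟨t₀, ht₀⟩ hγ
  have h := isGeodesicOn_geodesic_sub hf (γ t₀) (deriv γ t₀) t₀
  refine ⟨_, h, eqOn_of_isGeodesicOn hf hI hc
    ⟨h.1.mono (Set.subset_univ I), fun t _ => h.2 t trivial⟩ hγ ht₀ ?_ ?_⟩
  · simp [geodesic_zero]
  · rw [deriv_comp_sub_const, sub_self, deriv_geodesic_zero hf]

theorem expIsDiffeomorphism_metric1 (hf : ContDiff ℝ ∞ f) (P : R2p p) :
    (metric1 f hf).ExpIsDiffeomorphism P := by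
  refine ⟨expDiffeomorph hf P, fun v Q => ⟨?_, ?_⟩⟩
  · rintro ⟨I, γ, hI, hc, h01, hγ, rfl, rfl, rfl⟩
    have h := isGeodesicOn_geodesic hf (γ 0) (deriv γ 0)
    rw [← geodesic_one hf]
    exact eqOn_of_isGeodesicOn hf hI hc
      ⟨h.1.mono (Set.subset_univ I), fun t _ => h.2 t trivial⟩ hγ (h01 ⟨le_rfl, zero_le_one⟩)
      (geodesic_zero _ _) (deriv_geodesic_zero hf _ _) (h01 ⟨zero_le_one, le_rfl⟩)
  · rintro rfl
    exact ⟨Set.univ, geodesic f P v, isOpen_univ, Set.ordConnected_univ, Set.subset_univ _,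
      isGeodesicOn_geodesic hf P v, geodesic_zero P v, deriv_geodesic_zero hf P v,
      geodesic_one hf P v⟩

end Geodesics

/-! ### Irreducibility -/

section Irreducible

variable {p : ℕ}

theorem eq_bot_or_eq_bot_of_minors (hp : 2 ≤ p) {S T : Submodule ℝ (Fin p → ℝ)} (hST : S ⊔ T = ⊤)
    (h : ∀ u ∈ S, ∀ v ∈ T, ∀ i j, u i * v j = u j * v i) : S = ⊥ ∨ T = ⊥ := by
  by_contra! hne
  obtain ⟨u, hu, hu0⟩ := S.exists_mem_ne_zero_of_ne_bot hne.1
  obtain ⟨v, hv, hv0⟩ := T.exists_mem_ne_zero_of_ne_bot hne.2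
  obtain ⟨k, hk⟩ := Function.ne_iff.1 hv0
  have huk : u k ≠ 0 := by
    intro huk
    refine hu0 (funext fun i => ?_)
    have := h u hu v hv i k
    rw [huk, zero_mul] at this
    exact (mul_eq_zero.1 this).resolve_right hk
  have : Nontrivial (Fin p) := Fin.nontrivial_iff_two_le.2 hp
  obtain ⟨j, hj⟩ := exists_ne k
  obtain ⟨s, hs, t, ht, hst⟩ := Submodule.mem_sup.1 (hST ▸ Submodule.mem_top :
    (Pi.single j 1 : Fin p → ℝ) ∈ S ⊔ T)
  have hsj : s j + t j = 1 := by simpa using congrFun hst j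
  have hsk : s k + t k = 0 := by simpa [hj.symm] using congrFun hst k
  have e1 := h s hs v hv j k
  have e2 := h u hu t ht k j
  have e3 := h u hu v hv j k
  -- Multiply `hsj` by u_k v_k: the minors turn the left side into u_k v_j (s_k + t_k), which is 0
  -- by `hsk`.
  have : v k * u k = 0 := by
    linear_combination (-(v k * u k)) * hsj + u k * e1 + v k * e2 + t k * e3 + u k * v j * hsk
  exact mul_ne_zero hk huk this

theorem eq_bot_or_eq_bot_of_neutralForm (hp : 2 ≤ p) (a : Fin p → ℝ) {V₁ V₂ : Submodule ℝ (R2p p)}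
    (hV : V₁ ⊔ V₂ = ⊤) (horth : ∀ x ∈ V₁, ∀ y ∈ V₂, neutralForm a x y = 0)
    (hpar : ∀ x ∈ V₁, ∀ y ∈ V₂, ∀ z w : Fin p → ℝ,
      (x.1 ⬝ᵥ w) * (y.1 ⬝ᵥ z) = (x.1 ⬝ᵥ z) * (y.1 ⬝ᵥ w)) : V₁ = ⊥ ∨ V₂ = ⊥ := by
  -- A summand without x-part lies in the totally null y-space. It is then orthogonal to itself as
  -- well as to the other summand, hence zero.
  have key : ∀ {W₁ W₂ : Submodule ℝ (R2p p)}, W₁ ⊔ W₂ = ⊤ →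
      (∀ x ∈ W₁, ∀ y ∈ W₂, neutralForm a x y = 0) →
      W₁.map (LinearMap.fst ℝ _ _) = ⊥ → W₁ = ⊥ := by
    intro W₁ W₂ hW ho hb
    rw [Submodule.eq_bot_iff]
    have hfst : ∀ x ∈ W₁, x.1 = 0 := fun x hx => by
      have : x.1 ∈ W₁.map (LinearMap.fst ℝ _ _) := ⟨x, hx, rfl⟩
      rwa [hb, Submodule.mem_bot] at this
    intro x hx
    refine (neutralForm_nondegenerate a).1 x fun y => ?_
    obtain ⟨y₁, h₁, y₂, h₂, rfl⟩ := Submodule.mem_sup.1 (hW ▸ Submodule.mem_top : y ∈ W₁ ⊔ W₂)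
    rw [map_add, ho x hx y₂ h₂, neutralForm_eq_dotProduct, hfst x hx, hfst y₁ h₁]
    simp
  have hs : V₁.map (LinearMap.fst ℝ (Fin p → ℝ) (Fin p → ℝ))
      ⊔ V₂.map (LinearMap.fst ℝ (Fin p → ℝ) (Fin p → ℝ)) = ⊤ := by
    rw [← Submodule.map_sup, hV, Submodule.map_top, Submodule.range_fst]
  rcases eq_bot_or_eq_bot_of_minors hp hs (by
    rintro _ ⟨x, hx, rfl⟩ _ ⟨y, hy, rfl⟩ i j
    simpa using hpar x hx y hy (Pi.single j 1) (Pi.single i 1)) with h | h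
  · exact Or.inl (key hV horth h)
  · refine Or.inr (key (sup_comm V₁ V₂ ▸ hV) (fun x hx y hy => ?_) h)
    rw [neutralForm_symm]
    exact horth y hy x hx

/-- The factor c lets this serve both the model (c = 1) and the tangent spaces for f = |x|² (c = 4).
-/
theorem isIrreducibleModel_neutralForm (hp : 2 ≤ p) (a : Fin p → ℝ) {c : ℝ} (hc : c ≠ 0) :
    IsIrreducibleModel (fun x y : R2p p => neutralForm a x y) (fun x y z w : R2p p =>
      c * ((x.1 ⬝ᵥ w.1) * (y.1 ⬝ᵥ z.1) - (x.1 ⬝ᵥ z.1) * (y.1 ⬝ᵥ w.1))) := by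
  have : Nonempty (Fin p) := ⟨⟨0, by omega⟩⟩
  refine ⟨inferInstance, fun V₁ V₂ h => ?_⟩
  have hs := h.isCompl.sup_eq_top
  refine eq_bot_or_eq_bot_of_neutralForm hp a hs (fun x hx y hy => ?_) fun x hx y hy z w => ?_
  · simpa using h.g_split x hx 0 V₁.zero_mem 0 V₂.zero_mem y hy
  · obtain ⟨z₁, hz₁, z₂, hz₂, hz⟩ := Submodule.mem_sup.1
      (hs ▸ Submodule.mem_top : ((z, 0) : R2p p) ∈ V₁ ⊔ V₂)
    obtain ⟨w₁, hw₁, w₂, hw₂, hw⟩ := Submodule.mem_sup.1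
      (hs ▸ Submodule.mem_top : ((w, 0) : R2p p) ∈ V₁ ⊔ V₂)
    -- The mixed component A(x, y, z, w) vanishes, since each term on the right has a zero entry.
    have e := h.A_split x hx 0 V₁.zero_mem z₁ hz₁ w₁ hw₁ 0 V₂.zero_mem y hy z₂ hz₂ w₂ hw₂
    rw [hz, hw] at e
    simpa [hc, sub_eq_zero] using e

theorem isIrreducible_model1 (hp : 2 ≤ p) : (model1 p).IsIrreducible := by
  have h := isIrreducibleModel_neutralForm hp 0 one_ne_zero
  simp only [one_mul] at h
  exact h

end Irreducible

/-! ### The model of the tangent spaces -/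

section ZeroModel

open scoped Matrix MatrixOrder

variable {p : ℕ} {f : (Fin p → ℝ) → ℝ}

theorem isZeroModel_metric1 (hf : ContDiff ℝ ∞ f) (hH : ∀ x, (hess f x).PosDef) :
    (metric1 f hf).IsZeroModel (model1 p) := by
  intro P
  obtain ⟨B, hB⟩ := CStarAlgebra.nonneg_iff_eq_star_mul_self.1 (hH P.1).posSemidef.nonneg
  have hB' : hess f P.1 = Bᵀ * B := hB
  have hdet : IsUnit B.det := by
    have := (hH P.1).det_pos
    rw [hB', Matrix.det_mul] at this
    exact isUnit_iff_ne_zero.2 (right_ne_zero_of_mul this.ne')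
  have hform : ∀ u v, hessForm f P.1 u v = B.mulVec u ⬝ᵥ B.mulVec v := by
    intro u v
    rw [hessForm, hB', ← Matrix.mulVec_mulVec, Matrix.dotProduct_mulVec, Matrix.vecMul_transpose]
  have hdual : ∀ u v, B.mulVec u ⬝ᵥ (B⁻¹)ᵀ.mulVec v = u ⬝ᵥ v := by
    intro u v
    rw [Matrix.dotProduct_mulVec, Matrix.vecMul_transpose, Matrix.mulVec_mulVec,
      Matrix.nonsing_inv_mul _ hdet, Matrix.one_mulVec]
  -- `B` turns the Hessian form into the dot product, its inverse transpose keeps the x-y pairing,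
  -- and the half shift along ∇f absorbs the square of df into that pairing.
  let L : R2p p →ₗ[ℝ] R2p p := LinearMap.prod (B.mulVecLin ∘ₗ LinearMap.fst ℝ _ _)
    ((B⁻¹)ᵀ.mulVecLin ∘ₗ (LinearMap.snd ℝ _ _ + (1 / 2 : ℝ) •
      (dotProductBilin ℝ ℝ (grad f P.1)).smulRight (grad f P.1) ∘ₗ LinearMap.fst ℝ _ _))
  have hL : ∀ u, L u = (B.mulVec u.1, (B⁻¹)ᵀ.mulVec
      (u.2 + (1 / 2 : ℝ) • (grad f P.1 ⬝ᵥ u.1) • grad f P.1)) := fun u => rfl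
  have hg : ∀ u v, (model1 p).g (L u) (L v) = (metric1 f hf).val P u v := by
    intro u v
    change neutralForm 0 _ _ = _
    rw [neutralForm_eq_dotProduct, hL, hL, metric1_val]
    simp only [hdual, dotProduct_comm _ (B.mulVec v.1)]
    simp [dotProduct_comm _ (grad f P.1), dotProduct_comm v.1 u.2]
    ring
  have hinj : Function.Injective L := by
    refine (injective_iff_map_eq_zero L).2 fun u hu => ((metric1 f hf).nondeg P).1 u fun v => ?_
    rw [← hg, hu, map_zero, LinearMap.zero_apply]
  refine ⟨LinearEquiv.ofInjectiveEndo L hinj, hg, fun x y z w => ?_⟩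
  rw [curv_metric1, hform, hform, hform, hform]
  exact modelCurv_apply p _ _ _ _

end ZeroModel

/-! ### The symmetric space `f = x₁² + ⋯ + x_p²` -/

section Symmetric

variable {p : ℕ}

theorem contDiff_sum_sq : ContDiff ℝ ∞ fun x : Fin p → ℝ => ∑ i, x i ^ 2 :=
  ContDiff.sum fun i _ => (contDiff_apply ℝ ℝ i).pow 2

theorem grad_sum_sq : grad (fun x : Fin p → ℝ => ∑ i, x i ^ 2) = fun x => (2 : ℝ) • x := by
  funext x i
  have h : HasFDerivAt (fun x : Fin p → ℝ => ∑ i, x i ^ 2)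
      (∑ i, (2 * x i) • ContinuousLinearMap.proj (R := ℝ) (φ := fun _ : Fin p => ℝ) i) x := by
    refine HasFDerivAt.fun_sum fun i _ => ?_
    simpa using (hasFDerivAt_apply (𝕜 := ℝ) i x).pow 2
  rw [grad, pderiv, h.fderiv]
  simp [Pi.single_apply]

theorem hessForm_sum_sq (x u v : Fin p → ℝ) :
    hessForm (fun x : Fin p → ℝ => ∑ i, x i ^ 2) x u v = 2 * (u ⬝ᵥ v) := by
  have h : HasFDerivAt (𝕜 := ℝ) (fun x : Fin p → ℝ => (2 : ℝ) • x)
      ((2 : ℝ) • ContinuousLinearMap.id ℝ (Fin p → ℝ)) x :=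
    (hasFDerivAt_id x).const_smul (2 : ℝ)
  rw [hessForm, ← fderiv_grad_apply contDiff_sum_sq, grad_sum_sq, h.fderiv]
  simp

theorem curv_sum_sq (P x y z w : R2p p) :
    (metric1 _ contDiff_sum_sq).curv P x y z w
      = 4 * ((x.1 ⬝ᵥ w.1) * (y.1 ⬝ᵥ z.1) - (x.1 ⬝ᵥ z.1) * (y.1 ⬝ᵥ w.1)) := by
  simp only [curv_metric1, hessForm_sum_sq]
  ring

/-- The geodesic symmetry at `P`. -/
def pointReflection (P Q : R2p p) : R2p p :=
  ((2 : ℝ) • P.1 - Q.1,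
    -- From exp_P(v) ↦ exp_P(-v): with a = Q.1 - P.1 the correction is `expShift` at a plus
    -- `expShift` at -a. Here `expShift` is 2|a|²P.1 + (2/3)|a|²a, and only its even part survives.
    (2 : ℝ) • P.2 - Q.2 - (4 * ((Q.1 - P.1) ⬝ᵥ (Q.1 - P.1))) • P.1)

theorem pointReflection_pointReflection (P Q : R2p p) :
    pointReflection P (pointReflection P Q) = Q := by
  have h : (2 : ℝ) • P.1 - Q.1 - P.1 = -(Q.1 - P.1) := by
    rw [two_smul]
    abel
  simp only [pointReflection, h, neg_dotProduct_neg]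
  ext i
  · simp
  · simp
    ring

theorem contDiff_pointReflection (P : R2p p) : ContDiff ℝ ∞ (pointReflection P) := by
  have h : ContDiff ℝ ∞ fun Q : R2p p => Q.1 - P.1 := contDiff_fst.sub contDiff_const
  exact (contDiff_const.sub contDiff_fst).prodMk ((contDiff_const.sub contDiff_snd).sub
    ((contDiff_const.mul (contDiff_dotProduct_left h h)).smul contDiff_const))

theorem fderiv_pointReflection (P Q u : R2p p) :
    fderiv ℝ (pointReflection P) Q u
      = (-u.1, -u.2 - (8 * ((Q.1 - P.1) ⬝ᵥ u.1)) • P.1) := by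
  have h1 := ((contDiff_pointReflection P).differentiable (by simp) Q).hasFDerivAt.hasLineDerivAt u
  refine h1.unique ?_
  -- The map is quadratic, so along a line it is an exact polynomial in t whose linear coefficient
  -- is the derivative.
  have hline : (fun t : ℝ => pointReflection P (Q + t • u)) = fun t : ℝ =>
      pointReflection P Q + t • ((-u.1, -u.2 - (8 * ((Q.1 - P.1) ⬝ᵥ u.1)) • P.1) : R2p p)
        + t ^ 2 • ((0, (-4 * (u.1 ⬝ᵥ u.1)) • P.1) : R2p p) := by
    funext t
    have e : Q.1 + t • u.1 - P.1 = (Q.1 - P.1) + t • u.1 := by abel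
    simp only [pointReflection, Prod.fst_add, Prod.smul_fst, e, add_dotProduct, dotProduct_add,
      smul_dotProduct, dotProduct_smul, dotProduct_comm u.1 (Q.1 - P.1)]
    ext i
    · simp
      ring
    · simp
      ring
  have h2 := (((hasDerivAt_id (0 : ℝ)).smul_const
      ((-u.1, -u.2 - (8 * ((Q.1 - P.1) ⬝ᵥ u.1)) • P.1) : R2p p)).const_add
      (pointReflection P Q)).add
    (((hasDerivAt_id (0 : ℝ)).pow 2).smul_const ((0, (-4 * (u.1 ⬝ᵥ u.1)) • P.1) : R2p p))
  change HasDerivAt (fun t : ℝ => pointReflection P (Q + t • u)) _ 0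
  rw [hline]
  refine h2.congr_deriv ?_
  simp

theorem isSymmetricSpace_sum_sq : (metric1 (p := p) _ contDiff_sum_sq).IsSymmetricSpace := by
  intro P
  let S : R2p p ≃ₘ^∞⟮𝓘(ℝ, R2p p), 𝓘(ℝ, R2p p)⟯ R2p p :=
    { toFun := pointReflection P
      invFun := pointReflection P
      left_inv := pointReflection_pointReflection P
      right_inv := pointReflection_pointReflection P
      contMDiff_toFun := (contDiff_pointReflection P).contMDiff
      contMDiff_invFun := (contDiff_pointReflection P).contMDiff }
  have hS : ⇑S = pointReflection P := rfl
  refine ⟨S, fun Q u v => ?_, ?_, fun v => ?_⟩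
  · rw [hS, fderiv_pointReflection, fderiv_pointReflection, metric1_val, metric1_val, grad_sum_sq]
    simp only [pointReflection, smul_dotProduct, sub_dotProduct, dotProduct_sub, dotProduct_neg,
      neg_dotProduct, dotProduct_smul, smul_eq_mul, dotProduct_comm _ P.1]
    ring
  · rw [hS]
    ext i
    · simp [pointReflection]
      ring
    · simp [pointReflection]
      ring
  · rw [hS, fderiv_pointReflection]
    simp
    rfl

/-! ### Parallel transport -/

theorem isParallelAlong_const (γ : ℝ → R2p p) (b : Fin p → ℝ) :
    (metric1 (p := p) _ contDiff_sum_sq).IsParallelAlong γ fun _ => (0, b) := by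
  refine ⟨contDiff_const, fun t => ?_⟩
  simp [christoffel_metric1]

/-- Parallel transport along a curve in the `x`-plane through `P` spanned by `e` and `h`. -/
theorem isParallelAlong_plane (P u : R2p p) (e h : Fin p → ℝ) {α β J α' β' : ℝ → ℝ}
    (hα : ContDiff ℝ ∞ α) (hβ : ContDiff ℝ ∞ β) (hJ : ContDiff ℝ ∞ J)
    (dα : ∀ t, HasDerivAt α (α' t) t) (dβ : ∀ t, HasDerivAt β (β' t) t)
    (dJ : ∀ t, HasDerivAt J (α' t * β t) t) :
    (metric1 (p := p) _ contDiff_sum_sq).IsParallelAlong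
      (fun t => (P.1 + α t • e + β t • h, P.2))
      (fun t => (u.1, u.2 - (4 : ℝ) • ((α t * (e ⬝ᵥ u.1) + β t * (h ⬝ᵥ u.1)) • P.1
        + (α t ^ 2 / 2 * (e ⬝ᵥ u.1) + (α t * β t - J t) * (h ⬝ᵥ u.1)) • e
        + (β t ^ 2 / 2 * (h ⬝ᵥ u.1) + J t * (e ⬝ᵥ u.1)) • h))) := by
  -- The x-part stays constant and the y-part solves V' = -4 (x'·u) x. Its primitive needs ∫α'β,
  -- which is J, and ∫αβ', which is αβ - J up to a constant.
  constructor
  · fun_prop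
  · intro t
    have hγ : HasDerivAt (fun t => ((P.1 + α t • e + β t • h, P.2) : R2p p))
        (α' t • e + β' t • h, 0) t :=
      ((((dα t).smul_const e).const_add P.1).add ((dβ t).smul_const h)).prodMk
        (hasDerivAt_const t P.2)
    have hV := (hasDerivAt_const t u.1).prodMk
      (((((((dα t).mul_const (e ⬝ᵥ u.1)).add ((dβ t).mul_const (h ⬝ᵥ u.1))).smul_const P.1).add
        ((((((dα t).fun_pow 2).div_const 2).mul_const (e ⬝ᵥ u.1)).add
          ((((dα t).mul (dβ t)).sub (dJ t)).mul_const (h ⬝ᵥ u.1))).smul_const e)).add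
        ((((((dβ t).fun_pow 2).div_const 2).mul_const (h ⬝ᵥ u.1)).add
          ((dJ t).mul_const (e ⬝ᵥ u.1))).smul_const h)).const_smul (4 : ℝ) |>.const_sub u.2)
    rw [hγ.deriv, christoffel_metric1, hessForm_sum_sq, grad_sum_sq]
    refine (congrArg (· + _) hV.deriv).trans ?_
    ext i
    · simp
    · simp [add_dotProduct]
      ring

/-- Transport around a loop based at P returns a vector of D(P). Its difference from u is a multiple
of the stated vector, the coefficient being given by the signed area ∫α'β. -/
theorem mem_of_isParallelDistribution {D : R2p p → Submodule ℝ (R2p p)}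
    (hD : (metric1 (p := p) _ contDiff_sum_sq).IsParallelDistribution D) {P u : R2p p}
    (hu : u ∈ D P) (e h : Fin p → ℝ) :
    ((0, (e ⬝ᵥ u.1) • h - (h ⬝ᵥ u.1) • e) : R2p p) ∈ D P := by
  have dα : ∀ t : ℝ, HasDerivAt (fun t : ℝ => t - t ^ 2) (1 - 2 * t) t := fun t => by
    simpa using (hasDerivAt_id t).fun_sub ((hasDerivAt_id t).fun_pow 2)
  have dβ : ∀ t : ℝ, HasDerivAt (fun t : ℝ => t ^ 2 - t ^ 3) (2 * t - 3 * t ^ 2) t := fun t => by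
    simpa using ((hasDerivAt_id t).fun_pow 2).fun_sub ((hasDerivAt_id t).fun_pow 3)
  have dJ : ∀ t : ℝ, HasDerivAt (fun t : ℝ => t ^ 3 / 3 - 3 * t ^ 4 / 4 + 2 * t ^ 5 / 5)
      ((1 - 2 * t) * (t ^ 2 - t ^ 3)) t := fun t => by
    refine (((((hasDerivAt_id t).fun_pow 3).div_const 3).fun_sub
      ((((hasDerivAt_id t).fun_pow 4).const_mul 3).div_const 4)).fun_add
      ((((hasDerivAt_id t).fun_pow 5).const_mul 2).div_const 5)).congr_deriv ?_
    simp
    ring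
  have key := hD _ _ (by fun_prop) (isParallelAlong_plane P u e h (by fun_prop) (by fun_prop)
    (by fun_prop) dα dβ dJ) 0 1
  norm_num at key
  -- Both α and β vanish at 0 and 1, while J(1) = 1/3 - 3/4 + 2/5 = -1/60. The displacement is
  -- -4J(1) = 1/15 times the wanted vector.
  have hmem := (D P).smul_mem 15 ((D P).sub_mem (key hu) hu)
  convert hmem using 1
  ext i
  · simp
  · simp
    ring

theorem isIndecomposable_sum_sq (hp : 2 ≤ p) :
    (metric1 (p := p) _ contDiff_sum_sq).IsIndecomposable := by
  intro D₁ D₂ h₁ h₂ hc ho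
  have hpt : ∀ P, D₁ P = ⊥ ∨ D₂ P = ⊥ := by
    intro P
    refine eq_bot_or_eq_bot_of_neutralForm hp _ (hc P).sup_eq_top (ho P) fun x hx y hy z w => ?_
    have h := ho P _ (mem_of_isParallelDistribution h₁ hx w z) y hy
    rw [metric1_val] at h
    simp [sub_eq_zero, dotProduct_comm _ x.1, dotProduct_comm _ y.1] at h
    exact h
  -- The pointwise alternative cannot switch between points: a constant y-field is parallel, so a
  -- nonzero vector of D(Q) = ⊤ would be transported into D(0) = ⊥.
  have htop : ∀ {D : R2p p → Submodule ℝ (R2p p)},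
      (metric1 (p := p) _ contDiff_sum_sq).IsParallelDistribution D → D 0 = ⊥ →
      ∀ Q, D Q ≠ ⊤ := by
    intro D hD h0 Q hQ
    have h := hD (fun t => t • Q) _ (contDiff_id.smul contDiff_const)
      (isParallelAlong_const _ (Pi.single ⟨0, by omega⟩ 1)) 1 0
    simp [h0, hQ] at h
  rcases hpt 0 with h | h
  · refine Or.inl fun Q => (hpt Q).resolve_right fun hQ => htop h₁ h Q ?_
    simpa [hQ] using (hc Q).sup_eq_top
  · refine Or.inr fun Q => (hpt Q).resolve_left fun hQ => htop h₂ h Q ?_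
    simpa [hQ] using (hc Q).sup_eq_top

theorem isIrreducible_sum_sq (hp : 2 ≤ p) :
    (metric1 (p := p) _ contDiff_sum_sq).IsIrreducible := by
  refine ⟨fun P => ?_, isIndecomposable_sum_sq hp⟩
  have h := isIrreducibleModel_neutralForm hp
    (grad (fun x : Fin p → ℝ => ∑ i, x i ^ 2) P.1) four_ne_zero
  simp only [← curv_sum_sq P] at h
  exact h

end Symmetric

/-! ### A positive form is determined by its `2 × 2` minors -/

/-- In dimension at least 3, any x ≠ 0 extends to an H-orthogonal triple x, y, z. The minors make
the triple K-orthogonal too, and the products of pairs of diagonal entries agree, so H(x, x)² = K(x,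
x)². Signs and polarisation finish. -/
theorem bilinForm_eq_of_minors_eq {V : Type*} [AddCommGroup V] [Module ℝ V]
    [FiniteDimensional ℝ V] (h3 : 3 ≤ Module.finrank ℝ V) {H K : LinearMap.BilinForm ℝ V}
    (hHs : ∀ x y, H x y = H y x) (hKs : ∀ x y, K x y = K y x) (hH : ∀ x, x ≠ 0 → 0 < H x x)
    (hK : ∀ x, 0 ≤ K x x)
    (h : ∀ x y z w, H x w * H y z - H x z * H y w = K x w * K y z - K x z * K y w) : H = K := by
  have hex : ∀ x y, ∃ z, z ≠ 0 ∧ H x z = 0 ∧ H y z = 0 := by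
    intro x y
    obtain ⟨z, hz, hz0⟩ := Submodule.exists_mem_ne_zero_of_ne_bot
      (LinearMap.ker_ne_bot_of_finrank_lt (f := (H x).prod (H y))
        (by rw [Module.finrank_prod, Module.finrank_self]; omega))
    have := LinearMap.mem_ker.1 hz
    exact ⟨z, hz0, congrArg Prod.fst this, congrArg Prod.snd this⟩
  have hdiag : ∀ x, H x x = K x x := by
    intro x
    rcases eq_or_ne x 0 with rfl | hx
    · simp
    obtain ⟨y, hy, hxy, -⟩ := hex x x
    obtain ⟨z, hz, hxz, hyz⟩ := hex x y
    have px := hH x hx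
    have py := hH y hy
    have pz := hH z hz
    have e12 := h x y y x
    have e13 := h x z z x
    have e23 := h y z z y
    have f1 := h x y y z
    have f2 := h x z z y
    have f3 := h x y x z
    rw [hHs y x, hKs y x, hxy] at e12
    rw [hHs z x, hKs z x, hxz] at e13
    rw [hHs z y, hKs z y, hyz] at e23
    rw [hxy, hxz] at f1
    rw [hHs z y, hKs z y, hxy, hxz] at f2
    rw [hHs y x, hKs y x, hxz, hyz] at f3
    -- The pair (K x y, K x z) solves a homogeneous 2 × 2 system, `f1` and `f2`, with determinant
    -- H(y, y) H(z, z) > 0 by `e23`.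
    have h12 : K x y = 0 := by
      have : K x y * (H y y * H z z) = 0 := by
        linear_combination K x y * e23 - K y y * f2 - K y z * f1
      exact (mul_eq_zero.1 this).resolve_right (mul_pos py pz).ne'
    have h13 : K x z = 0 := by
      have : K x z * (H y y * H z z) = 0 := by
        linear_combination K x z * e23 - K z z * f1 - K y z * f2
      exact (mul_eq_zero.1 this).resolve_right (mul_pos py pz).ne'
    rw [h12] at e12 f3
    rw [h13] at e13 f3
    have kx : K x x ≠ 0 := by
      intro h0
      rw [h0] at e12
      nlinarith [mul_pos px py]
    have h23 : K y z = 0 := by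
      have : K x x * K y z = 0 := by linear_combination f3
      exact (mul_eq_zero.1 this).resolve_left kx
    rw [h23] at e23
    have hsq : (H x x ^ 2 - K x x ^ 2) * (H y y * H z z) = 0 := by
      linear_combination H x x * H z z * e12 + K x x * K y y * e13 - K x x ^ 2 * e23
    have := (mul_eq_zero.1 hsq).resolve_right (mul_pos py pz).ne'
    nlinarith [hK x]
  refine LinearMap.ext₂ fun x y => ?_
  have := hdiag (x + y)
  simp only [map_add, LinearMap.add_apply, hHs y x, hKs y x] at this
  linarith [hdiag x, hdiag y]

/-! ### Square norms of multilinear forms -/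

section KroneckerPower

open scoped Matrix

variable {p : ℕ} {ι : Type*} [Fintype ι] [DecidableEq ι]

/-- The Kronecker power of a matrix, its factors being indexed by `ι`. -/
def kroneckerPower (ι : Type*) [Fintype ι] (M : Matrix (Fin p) (Fin p) ℝ) :
    Matrix (ι → Fin p) (ι → Fin p) ℝ :=
  Matrix.of fun a s => ∏ i, M (a i) (s i)

theorem kroneckerPower_mul (M N : Matrix (Fin p) (Fin p) ℝ) :
    kroneckerPower ι (M * N) = kroneckerPower ι M * kroneckerPower ι N := by
  ext a s
  simp only [kroneckerPower, Matrix.of_apply, Matrix.mul_apply, Finset.prod_univ_sum,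
    Fintype.piFinset_univ, Finset.prod_mul_distrib]

omit [DecidableEq ι] in
theorem kroneckerPower_transpose (M : Matrix (Fin p) (Fin p) ℝ) :
    kroneckerPower ι Mᵀ = (kroneckerPower ι M)ᵀ := rfl

def tensorComponents (T : MultilinearMap ℝ (fun _ : ι => Fin p → ℝ) ℝ) (a : ι → Fin p) : ℝ :=
  T fun i => Pi.single (a i) 1

theorem tensorComponents_compLinearMap (T : MultilinearMap ℝ (fun _ : ι => Fin p → ℝ) ℝ)
    (C : Matrix (Fin p) (Fin p) ℝ) :
    tensorComponents (T.compLinearMap fun _ => Matrix.toLin' C)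
      = (kroneckerPower ι C)ᵀ *ᵥ tensorComponents T := by
  funext a
  have h : ∀ i, Matrix.toLin' C (Pi.single (a i) 1)
      = ∑ k, C k (a i) • (Pi.single k 1 : Fin p → ℝ) := fun i => by
    ext j
    simp [Finset.sum_apply, Pi.single_apply]
  simp only [tensorComponents, MultilinearMap.compLinearMap_apply, h, MultilinearMap.map_sum,
    MultilinearMap.map_smul_univ, Matrix.mulVec, dotProduct, kroneckerPower, Matrix.transpose_apply,
    Matrix.of_apply, smul_eq_mul]

/-- The square norm of a multilinear form with respect to the inverse metric `M`. -/
def tensorNormSq (M : Matrix (Fin p) (Fin p) ℝ)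
    (T : MultilinearMap ℝ (fun _ : ι => Fin p → ℝ) ℝ) : ℝ :=
  tensorComponents T ⬝ᵥ kroneckerPower ι M *ᵥ tensorComponents T

/-- As a quadratic form of a Kronecker power, the norm changes basis by associativity of matrix
products. -/
theorem tensorNormSq_compLinearMap (M C : Matrix (Fin p) (Fin p) ℝ)
    (T : MultilinearMap ℝ (fun _ : ι => Fin p → ℝ) ℝ) :
    tensorNormSq M (T.compLinearMap fun _ => Matrix.toLin' C) = tensorNormSq (C * M * Cᵀ) T := by
  rw [tensorNormSq, tensorNormSq, tensorComponents_compLinearMap, kroneckerPower_mul,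
    kroneckerPower_mul, kroneckerPower_transpose, ← Matrix.mulVec_mulVec, ← Matrix.mulVec_mulVec,
    Matrix.mulVec_transpose, ← Matrix.dotProduct_mulVec]

theorem sum_fin_five {α : Type*} [Fintype α] (F : (Fin 5 → α) → ℝ) :
    ∑ a, F a = ∑ a, ∑ b, ∑ c, ∑ d, ∑ e, F ![a, b, c, d, e] := by
  let E : α × α × α × α × α ≃ (Fin 5 → α) :=
    { toFun := fun q => ![q.1, q.2.1, q.2.2.1, q.2.2.2.1, q.2.2.2.2]
      invFun := fun a => (a 0, a 1, a 2, a 3, a 4)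
      left_inv := fun q => rfl
      right_inv := fun a => by
        funext i
        fin_cases i <;> rfl }
  rw [← E.sum_comp]
  simp only [Fintype.sum_prod_type]
  rfl

end KroneckerPower

/-! ### `α₁` is an invariant of the `1`-model -/

section OneModel

open scoped Matrix

variable {p : ℕ} {f : (Fin p → ℝ) → ℝ}

/-- `T` is an argument because `hessCurvDeriv` is a bare function; the multilinear structure will
come from the tensor `A1` of the model. -/
theorem alpha1_eq_tensorNormSq (hf : ContDiff ℝ ∞ f) (P : R2p p)
    (T : MultilinearMap ℝ (fun _ : Fin 5 => Fin p → ℝ) ℝ)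
    (hT : ∀ v, T v = hessCurvDeriv f P.1 (v 0) (v 1) (v 2) (v 3) (v 4)) :
    alpha1 f hf P = tensorNormSq (hess f P.1)⁻¹ T := by
  have h : ∀ a b c d e : Fin p, tensorComponents T ![a, b, c, d, e]
      = (metric1 f hf).covCurv P (dx a) (dx b) (dx c) (dx d) (dx e) := fun a b c d e => by
    rw [covCurv_metric1_eq_hessCurvDeriv, tensorComponents, hT]
    rfl
  simp only [tensorNormSq, dotProduct, Matrix.mulVec, sum_fin_five, h, Finset.mul_sum, alpha1]
  congr! 10 with a _ b _ c _ d _ e _ s _ t _ u _ v _ w _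
  simp only [kroneckerPower, Matrix.of_apply, Fin.prod_univ_five]
  simp
  ring

theorem hessForm_pos (hH : ∀ x, (hess f x).PosDef) (x : Fin p → ℝ) {u : Fin p → ℝ} (hu : u ≠ 0) :
    0 < hessForm f x u u := by
  simpa [hessForm] using (hH x).dotProduct_mulVec_pos hu

theorem toBilin'_hess (x u v : Fin p → ℝ) :
    Matrix.toBilin' (hess f x) u v = hessForm f x u v :=
  Matrix.toBilin'_apply' _ _ _

/-- `C` is not known to be injective here, so the pulled-back form is only seen to be nonnegative,
which is all that `bilinForm_eq_of_minors_eq` asks of K. -/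
theorem hessForm_eq_of_minors_eq (hp : 3 ≤ p) (hf : ContDiff ℝ ∞ f)
    (hH : ∀ x, (hess f x).PosDef) (a b : Fin p → ℝ) (C : (Fin p → ℝ) →ₗ[ℝ] (Fin p → ℝ))
    (h : ∀ x y z w, hessForm f a x w * hessForm f a y z - hessForm f a x z * hessForm f a y w
      = hessForm f b (C x) (C w) * hessForm f b (C y) (C z)
        - hessForm f b (C x) (C z) * hessForm f b (C y) (C w)) (u v : Fin p → ℝ) :
    hessForm f a u v = hessForm f b (C u) (C v) := by
  have key : Matrix.toBilin' (hess f a) = (Matrix.toBilin' (hess f b)).compl₁₂ C C := by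
    refine bilinForm_eq_of_minors_eq (by simpa using hp) ?_ ?_ ?_ ?_ ?_
    · intro x y
      simp only [toBilin'_hess]
      exact hessForm_symm hf a x y
    · intro x y
      simp only [LinearMap.compl₁₂_apply, toBilin'_hess]
      exact hessForm_symm hf b _ _
    · intro x hx
      rw [toBilin'_hess]
      exact hessForm_pos hH a hx
    · intro x
      rw [LinearMap.compl₁₂_apply, toBilin'_hess]
      simpa [hessForm] using (hH b).posSemidef.dotProduct_mulVec_nonneg (C x)
    · intro x y z w
      simp only [LinearMap.compl₁₂_apply, toBilin'_hess]
      exact h x y z w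
  have := LinearMap.congr_fun₂ key u v
  rwa [LinearMap.compl₁₂_apply, toBilin'_hess, toBilin'_hess] at this

theorem inv_hess_eq (hH : ∀ x, (hess f x).PosDef) (a b : Fin p → ℝ)
    (C : Matrix (Fin p) (Fin p) ℝ) (h : hess f a = Cᵀ * hess f b * C) :
    C * (hess f a)⁻¹ * Cᵀ = (hess f b)⁻¹ := by
  have hdet : IsUnit C.det := by
    have := (hH a).det_pos
    rw [h, Matrix.det_mul] at this
    exact isUnit_iff_ne_zero.2 (right_ne_zero_of_mul this.ne')
  have hdet' : IsUnit Cᵀ.det := by rwa [Matrix.det_transpose]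
  rw [h, Matrix.mul_inv_rev, Matrix.mul_inv_rev, ← Matrix.mul_assoc, Matrix.mul_nonsing_inv _ hdet,
    Matrix.one_mul, Matrix.mul_assoc, Matrix.nonsing_inv_mul _ hdet', Matrix.mul_one]

theorem alpha1_eq_of_isOneModel (hp : 3 ≤ p) (hf : ContDiff ℝ ∞ f)
    (hH : ∀ x, (hess f x).PosDef) {V : Type*} [AddCommGroup V] [Module ℝ V] {U : OneModel V}
    (hU : (metric1 f hf).IsOneModel U) (P Q : R2p p) : alpha1 f hf P = alpha1 f hf Q := by
  obtain ⟨Φ, -, hΦ, hΦ'⟩ := hU P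
  obtain ⟨Θ, -, hΘ, hΘ'⟩ := hU Q
  let ψ : R2p p → R2p p := fun x => Θ.symm (Φ x)
  have hψ : ∀ x, Θ (ψ x) = Φ x := fun x => Θ.apply_symm_apply _
  -- Both R and ∇R depend only on x-components, so this block of ψ carries all that the comparison
  -- needs.
  let C : (Fin p → ℝ) →ₗ[ℝ] (Fin p → ℝ) :=
    LinearMap.fst ℝ _ _ ∘ₗ (Θ.symm : V →ₗ[ℝ] R2p p) ∘ₗ (Φ : R2p p →ₗ[ℝ] V) ∘ₗ LinearMap.inl ℝ _ _
  have hC : ∀ u, C u = (ψ (u, 0)).1 := fun u => rfl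
  have hform := hessForm_eq_of_minors_eq hp hf hH P.1 Q.1 C fun x y z w => by
    have h := hΘ (ψ (x, 0)) (ψ (y, 0)) (ψ (z, 0)) (ψ (w, 0))
    simp only [hψ] at h
    rw [hΦ, curv_metric1, curv_metric1] at h
    exact h
  have hmat : hess f P.1 = (LinearMap.toMatrix' C)ᵀ * hess f Q.1 * LinearMap.toMatrix' C := by
    refine Matrix.toBilin'.injective (LinearMap.ext₂ fun u v => ?_)
    rw [toBilin'_hess, hform, Matrix.toBilin'_apply', ← Matrix.mulVec_mulVec,
      ← Matrix.mulVec_mulVec, Matrix.dotProduct_mulVec, Matrix.vecMul_transpose,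
      LinearMap.toMatrix'_mulVec, LinearMap.toMatrix'_mulVec, hessForm]
  let T : MultilinearMap ℝ (fun _ : Fin 5 => Fin p → ℝ) ℝ :=
    U.A1.compLinearMap fun _ => (Θ : R2p p →ₗ[ℝ] V) ∘ₗ LinearMap.inl ℝ _ _
  have hT : ∀ v, T v = hessCurvDeriv f Q.1 (v 0) (v 1) (v 2) (v 3) (v 4) := by
    intro v
    have h := hΘ' (v 0, 0) (v 1, 0) (v 2, 0) (v 3, 0) (v 4, 0)
    rw [covCurv_metric1_eq_hessCurvDeriv] at h
    rw [← h]
    refine congrArg U.A1 (funext fun i => ?_)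
    fin_cases i <;> rfl
  have hTC : ∀ v, (T.compLinearMap fun _ => Matrix.toLin' (LinearMap.toMatrix' C)) v
      = hessCurvDeriv f P.1 (v 0) (v 1) (v 2) (v 3) (v 4) := by
    intro v
    have h := hΘ' (ψ (v 0, 0)) (ψ (v 1, 0)) (ψ (v 2, 0)) (ψ (v 3, 0)) (ψ (v 4, 0))
    simp only [hψ] at h
    rw [hΦ', covCurv_metric1_eq_hessCurvDeriv, covCurv_metric1_eq_hessCurvDeriv] at h
    rw [Matrix.toLin'_toMatrix', MultilinearMap.compLinearMap_apply, hT]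
    exact h.symm
  rw [alpha1_eq_tensorNormSq hf P _ hTC, alpha1_eq_tensorNormSq hf Q T hT,
    tensorNormSq_compLinearMap, inv_hess_eq hH P.1 Q.1 _ hmat]

theorem not_isOneCurvatureHomogeneous_metric1 (hp : 3 ≤ p) (hf : ContDiff ℝ ∞ f)
    (hH : ∀ x, (hess f x).PosDef) (hα : ¬ ∃ c : ℝ, ∀ P, alpha1 f hf P = c) :
    ¬ (metric1 f hf).IsOneCurvatureHomogeneous := by
  rintro ⟨V, _, _, U, hU⟩
  exact hα ⟨_, fun P => alpha1_eq_of_isOneModel hp hf hH hU P 0⟩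

end OneModel

end

theorem theorem1p3 (p : ℕ) (hp : 2 ≤ p) (f : (Fin p → ℝ) → ℝ) (hf : ContDiff ℝ ∞ f)
    (hH : ∀ x, (hess f x).PosDef) :
    -- the metric and the model inner product have neutral signature
    (∀ P, HasSignature ((metric1 f hf).val P) p p) ∧ HasSignature (model1 p).g p p ∧
    -- geodesic completeness
    (metric1 f hf).IsGeodesicallyComplete ∧
    -- the exponential maps are diffeomorphisms
    (∀ P, (metric1 f hf).ExpIsDiffeomorphism P) ∧
    -- the curvature tensor; its remaining components vanish
    (∀ (P : R2p p) (i j k l : Fin p),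
      (metric1 f hf).curv P (dx i) (dx j) (dx k) (dx l)
        = hess f P.1 i l * hess f P.1 j k - hess f P.1 i k * hess f P.1 j l) ∧
    (∀ (P : R2p p) (a : Fin 4 → Fin p ⊕ Fin p), (∃ m, (a m).isRight) →
      (metric1 f hf).curv P (coordVec (a 0)) (coordVec (a 1)) (coordVec (a 2)) (coordVec (a 3))
        = 0) ∧
    -- its covariant derivative; the remaining components vanish
    (∀ (P : R2p p) (i j k l n : Fin p),
      (metric1 f hf).covCurv P (dx i) (dx j) (dx k) (dx l) (dx n)
        = fderiv ℝ (fun Q => (metric1 f hf).curv Q (dx i) (dx j) (dx k) (dx l)) P (dx n)) ∧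
    (∀ (P : R2p p) (a : Fin 5 → Fin p ⊕ Fin p), (∃ m, (a m).isRight) →
      (metric1 f hf).covCurv P (coordVec (a 0)) (coordVec (a 1)) (coordVec (a 2)) (coordVec (a 3))
        (coordVec (a 4)) = 0) ∧
    -- an irreducible 0-model
    ((metric1 f hf).IsZeroModel (model1 p) ∧ (model1 p).IsIrreducible) ∧
    -- an irreducible symmetric space
    (f = (fun x => ∑ i, x i ^ 2) →
      (metric1 f hf).IsSymmetricSpace ∧ (metric1 f hf).IsIrreducible) ∧
    -- failure of 1-curvature homogeneity
    (3 ≤ p → (¬ ∃ c : ℝ, ∀ P, alpha1 f hf P = c) →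
      ¬ (metric1 f hf).IsOneCurvatureHomogeneous) := by
  refine ⟨fun P => hasSignature_neutralForm _, hasSignature_neutralForm 0,
    isGeodesicallyComplete_metric1 hf, expIsDiffeomorphism_metric1 hf, curv_metric1_dx hf,
    curv_metric1_coordVec hf, fun P i j k l n => covCurv_metric1 hf P _ _ _ _ _,
    covCurv_metric1_coordVec hf, ⟨isZeroModel_metric1 hf hH, isIrreducible_model1 hp⟩, ?_,
    fun hp3 => not_isOneCurvatureHomogeneous_metric1 hp3 hf hH⟩
  rintro rfl
  exact ⟨isSymmetricSpace_sum_sq, isIrreducible_sum_sq hp⟩
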